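/- All multigraphs are finite and loopless; multiple edges are allowed. A 5-graph is a 5-regular multigraph $G$ such that for every set $X \subseteq V(G)$ with $|X|$ odd, at least $5$ edges join $X$ to $V(G)\setminus X$. A plane multigraph is a multigraph together with an embedding in the plane (described combinatorially by its rotation system, i.e. the clockwise cyclic order of the edges around every vertex, of genus $0$ on every connected component). A super proper 5-edge-colouring of a plane 5-graph is a proper edge-colouring with the five colours green, light blue, dark blue, light red, dark red such that, in the cyclic order of the edges around any vertex, light blue and dark blue are never consecutive, and light red and dark red are never consecutive. Let $G$ be a plane $K_4$-minor-free 5-graph. (1) Let $\{c_1,c_2,c_3,c_4,c_5\}$ be a set of five distinct colours. Then $G$ has a proper edge-colouring with these colours such that at every vertex the cyclic order of the colours, read in either the clockwise or the anticlockwise direction, is $c_1,c_2,c_3,c_4,c_5$ or $c_1,c_4,c_5,c_2,c_3$. (2) Hence $G$ admits a super proper 5-edge-colouring. -/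

import Mathlib

open scoped Graph

/-- `H` is a minor of `G`: there are pairwise disjoint connected (nonempty) vertex sets of `G`,
one for every vertex of `H`, such that the sets of adjacent vertices of `H` are joined by an
edge of `G`. -/
def SimpleGraph.HasMinor {V W : Type*} (G : SimpleGraph V) (H : SimpleGraph W) : Prop :=
  ∃ B : W → Set V,
    (∀ i, (G.induce (B i)).Connected) ∧
    (∀ i j, i ≠ j → Disjoint (B i) (B j)) ∧
    (∀ i j, H.Adj i j → ∃ x ∈ B i, ∃ y ∈ B j, G.Adj x y)

namespace Graph

/-- A multigraph is `K₄`-minor-free if its underlying simple graph has no `K₄` minor (multiple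
edges are irrelevant for having a simple graph as a minor). -/
def IsK4MinorFree {α β : Type*} (G : Graph α β) : Prop :=
  ¬ G.toSimpleGraph.HasMinor (⊤ : SimpleGraph (Fin 4))

/-- The edges joining `X` to its complement. -/
def edgeBoundary {α β : Type*} (G : Graph α β) (X : Set α) : Set β :=
  {e | ∃ x ∈ X, ∃ y ∈ V(G) \ X, G.IsLink e x y}

/-- For a finite loopless multigraph: `G` is an `r`-graph if it is `r`-regular and every set of an
odd number of vertices is joined to its complement by at least `r` edges. -/
def IsRGraph {α β : Type*} (G : Graph α β) (r : ℕ) : Prop :=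
  (∀ v ∈ V(G), (G.incidenceSet v).ncard = r) ∧
  ∀ X ⊆ V(G), Odd X.ncard → r ≤ (G.edgeBoundary X).ncard

/-- An edge together with one of its ends: an edge leaving a vertex. In a loopless multigraph
every edge gives exactly two darts. -/
@[ext]
structure Dart {α β : Type*} (G : Graph α β) where
  /-- the vertex that the dart leaves -/
  vertex : α
  /-- the edge along which the dart leaves -/
  edge : β
  inc : G.Inc edge vertex

/-- The edge of a dart, as an element of the edge set. -/
def Dart.toEdge {α β : Type*} {G : Graph α β} (d : G.Dart) : E(G) := ⟨d.edge, d.inc.edge_mem⟩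

/-- The dart at the other end of the same edge. -/
noncomputable def Dart.rev {α β : Type*} {G : Graph α β} (d : G.Dart) : G.Dart :=
  ⟨d.inc.other, d.edge, d.inc.inc_other⟩

theorem Dart.rev_involutive {α β : Type*} {G : Graph α β} :
    Function.Involutive (Dart.rev : G.Dart → G.Dart) := by
  intro d
  have h1 := d.inc.isLink_other
  have h2 := d.rev.inc.isLink_other
  exact Dart.ext (h2.right_unique h1.symm) rfl

/-- A rotation system: for every vertex, a cyclic order of the edges at that vertex. The dart
`next d` is the clockwise successor of `d` around their common vertex. -/
structure RotationSystem {α β : Type*} (G : Graph α β) where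
  /-- the clockwise successor -/
  next : Equiv.Perm G.Dart
  vertex_next : ∀ d, (next d).vertex = d.vertex
  sameCycle_next : ∀ d d' : G.Dart, d.vertex = d'.vertex → next.SameCycle d d'

namespace RotationSystem

/-- The permutation that traces the facial walks: cross the edge, then turn. -/
noncomputable def facePerm {α β : Type*} {G : Graph α β} (ρ : G.RotationSystem) :
    Equiv.Perm G.Dart :=
  (Dart.rev_involutive (G := G)).toPerm.trans ρ.next

/-- The number of facial walks; an isolated vertex counts as one trivial facial walk. -/
noncomputable def faceCount {α β : Type*} {G : Graph α β} (ρ : G.RotationSystem) : ℕ :=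
  Nat.card (Quotient (Equiv.Perm.SameCycle.setoid ρ.facePerm)) +
    {v | v ∈ V(G) ∧ G.incidenceSet v = ∅}.ncard

/-- The rotation system of a finite loopless multigraph is that of an embedding in the plane: it
satisfies Euler's formula. Facial walks are counted component by component, so that Euler's
formula for `c` components reads `|V| - |E| + |F| = 2c`. Each component contributes at most `2`
to the left-hand side, so the equation says that each of them has genus `0`. -/
def IsPlane {α β : Type*} {G : Graph α β} (ρ : G.RotationSystem) : Prop :=
  (V(G).ncard : ℤ) - (E(G).ncard : ℤ) + (ρ.faceCount : ℤ) =
    2 * (Nat.card G.toSimpleGraph.ConnectedComponent : ℤ)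

/-- Read clockwise, from a suitable starting point, the colours of the edges at `v` are
`a 0, a 1, …, a (n - 1)`, every edge at `v` being read exactly once. -/
def ReadsClockwise {α β C : Type*} {G : Graph α β} (ρ : G.RotationSystem) (f : E(G) → C) (v : α)
    {n : ℕ} [NeZero n] (a : Fin n → C) : Prop :=
  ∃ t : Fin n ≃ {d : G.Dart // d.vertex = v},
    ∀ i, ρ.next (t i).1 = (t (i + 1)).1 ∧ f (t i).1.toEdge = a i

/-- The cyclic order of the colours at `v` is `a 0, a 1, …, a (n - 1)`, in either the clockwise or
the anticlockwise direction. -/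
def HasCyclicOrder {α β C : Type*} {G : Graph α β} (ρ : G.RotationSystem) (f : E(G) → C) (v : α)
    {n : ℕ} [NeZero n] (a : Fin n → C) : Prop :=
  ρ.ReadsClockwise f v a ∨ ρ.ReadsClockwise f v (fun i => a i.rev)

end RotationSystem

/-- Distinct edges with a common end get distinct colours. -/
def IsProperEdgeColouring {α β C : Type*} (G : Graph α β) (f : E(G) → C) : Prop :=
  ∀ (v : α) (e e' : E(G)), G.Inc e v → G.Inc e' v → e ≠ e' → f e ≠ f e'

/-- The five colours used in super proper edge-colourings. -/
inductive ShadeColour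
  | green
  | lightBlue
  | darkBlue
  | lightRed
  | darkRed

/-- A proper edge-colouring in which the two shades of blue are never consecutive around a vertex,
and neither are the two shades of red. -/
def RotationSystem.IsSuperProper {α β : Type*} {G : Graph α β} (ρ : G.RotationSystem)
    (f : E(G) → ShadeColour) : Prop :=
  G.IsProperEdgeColouring f ∧
  ∀ d : G.Dart,
    s(f d.toEdge, f (ρ.next d).toEdge) ≠ s(ShadeColour.lightBlue, ShadeColour.darkBlue) ∧
    s(f d.toEdge, f (ρ.next d).toEdge) ≠ s(ShadeColour.lightRed, ShadeColour.darkRed)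

end Graph

/-!
The proof is by induction on the number of darts. A `K₄`-minor-free graph has a vertex `v` with at
most two neighbours `u` and `w` (`SimpleGraph.hasMinor_top_four`: if all vertices of a finite graph
have three neighbours, a longest path carries a `K₄` minor). In a `5`-regular graph we may assume
that at least three of the edges at `v` go to `u`. In a plane `5`-graph these edges are consecutive
at `v` and at `u`, in opposite orders, so that the rotations at `u` and `v` are mirror images
(`FiveMap.exists_isMirror`). Hence `u` and `v` can be deleted and each of the at most two other
edges at `u` joined with the corresponding edge at `v`. The result is again a plane
`K₄`-minor-free `5`-graph (`FiveMap.IsMirror.reduce`), and a colouring of it extends: the edges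
outside the parallel class inherit their colours, and as there are at most two of them at `v`, which
are then consecutive at `w`, some admissible cyclic order at `v` contains these colours in the right
places. The mirror image is an admissible cyclic order at `u`.

Two reformulations make the induction short. A `5`-regular graph is a `5`-graph exactly if no edge
cut has one or three edges (`FiveMap.OddCut`). And planarity enters only through a combinatorial
Jordan curve theorem (`FiveMap.Jordan`): every even edge set is the boundary of a set of faces. It
follows from Euler's formula by a dimension count over `ZMod 2` (`FiveMap.jordan_of_euler`), and it
passes to the reduced graph by restricting the face colouring
(`FiveMap.IsMirror.jordan_reduce`).
With it, two parallel edges consecutive at one end are consecutive at the other end, because the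
part of the graph inside the digon would otherwise give a cut with one or three edges
(`FiveMap.Jordan.next_rev_next`).

Both orders `c₁c₂c₃c₄c₅` and `c₁c₄c₅c₂c₃` keep `c₂` apart from `c₄` and `c₃` apart from `c₅`, which
gives the super proper colouring.
-/

/-! ### Minors and the vertex with few neighbours -/

namespace SimpleGraph

/-- A minor of a minor is a minor: if disjoint connected sets `F x` of `G` realise the adjacencies
of `H`, then every minor of `H` is one of `G`. -/
theorem HasMinor.of_model {V U W : Type*} {G : SimpleGraph V} {H : SimpleGraph U}
    {K : SimpleGraph W} (F : U → Set V) (hconn : ∀ x, (G.induce (F x)).Connected)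
    (hdisj : ∀ x y, x ≠ y → Disjoint (F x) (F y))
    (hadj : ∀ x y, H.Adj x y → ∃ a ∈ F x, ∃ b ∈ F y, G.Adj a b) (h : H.HasMinor K) :
    G.HasMinor K := by
  obtain ⟨B, hB, hBdisj, hBadj⟩ := h
  refine ⟨fun i => ⋃ x ∈ B i, F x, fun i => ?_, fun i j hij => ?_, fun i j hij => ?_⟩
  · obtain ⟨⟨x₀, hx₀⟩⟩ := (hB i).nonempty
    -- grow the set from `F x₀` along a walk of `H` inside `B i`
    have key : ∀ x : B i, ∃ s : Set V, s ⊆ ⋃ x ∈ B i, F x ∧ F x₀ ⊆ s ∧ F x ⊆ s ∧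
        (G.induce s).Connected := by
      intro x
      have hr := (hB i).preconnected ⟨x₀, hx₀⟩ x
      rw [SimpleGraph.reachable_iff_reflTransGen] at hr
      induction hr with
      | refl => exact ⟨F x₀, Set.subset_biUnion_of_mem hx₀, subset_rfl, subset_rfl, hconn _⟩
      | @tail y z _ hyz ih =>
        obtain ⟨s, hs, h0, hy, hc⟩ := ih
        obtain ⟨a, ha, b, hb, hab⟩ := hadj _ _ hyz
        exact ⟨s ∪ F z, Set.union_subset hs (Set.subset_biUnion_of_mem z.2),
          h0.trans Set.subset_union_left, Set.subset_union_right,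
          connected_induce_union hc.preconnected (hconn _).preconnected (hy ha) hb hab⟩
    obtain ⟨⟨a, ha⟩⟩ := (hconn x₀).nonempty
    refine induce_connected_of_patches a (Set.mem_biUnion hx₀ ha) fun {v} hv => ?_
    simp only [Set.mem_iUnion] at hv
    obtain ⟨x, hx, hvx⟩ := hv
    obtain ⟨s, hs, h0, hsx, hc⟩ := key ⟨x, hx⟩
    exact ⟨s, hs, h0 ha, hsx hvx, hc.preconnected _ _⟩
  · simp only [Set.disjoint_iUnion_left, Set.disjoint_iUnion_right]
    intro x hx y hy
    exact hdisj _ _ (by rintro rfl; exact Set.disjoint_left.1 (hBdisj i j hij) hy hx)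
  · obtain ⟨x, hx, y, hy, hxy⟩ := hBadj i j hij
    obtain ⟨a, ha, b, hb, hab⟩ := hadj x y hxy
    exact ⟨a, Set.mem_biUnion hx ha, b, Set.mem_biUnion hy hb, hab⟩

theorem connected_induce_of_isChain {V : Type*} {G : SimpleGraph V} (l : List V) (hne : l ≠ [])
    (hl : l.IsChain G.Adj) : (G.induce {x | x ∈ l}).Connected := by
  induction l with
  | nil => exact absurd rfl hne
  | cons a l ih =>
    rcases l with _ | ⟨b, l⟩
    · have : {x | x ∈ [a]} = ({a} : Set V) := by ext; simp
      rw [this]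
      exact SimpleGraph.Connected.mk (by simp)
    · rw [List.isChain_cons_cons] at hl
      have h : {x | x ∈ a :: b :: l} = ({a} : Set V) ∪ {x | x ∈ b :: l} := by
        ext; simp
      rw [h]
      exact connected_induce_union (by simp) (ih (by simp) hl.2).preconnected
        (Set.mem_singleton a) (by simp) hl.1

/-- A path `P ++ z :: R` with a chord from its first vertex to `z`, where `P` has at least two
vertices. -/
def IsChordedPath {V : Type*} (G : SimpleGraph V) (P : List V) (z : V) (R : List V) : Prop :=
  (P ++ z :: R).IsChain G.Adj ∧ (P ++ z :: R).Nodup ∧ (∀ x ∈ P.head?, G.Adj x z) ∧ 2 ≤ P.length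

/-- Rotating a path at a chord of its first vertex: the initial segment is reversed. -/
theorem IsChordedPath.reverse {V : Type*} {G : SimpleGraph V} {P R : List V} {z : V}
    (h : G.IsChordedPath P z R) : G.IsChordedPath P.reverse z R := by
  obtain ⟨h1, h2, h3, h4⟩ := h
  rw [List.isChain_append] at h1
  refine ⟨?_, ?_, ?_, by simpa using h4⟩
  · rw [List.isChain_append, List.isChain_reverse]
    refine ⟨h1.1.imp fun _ _ h => h.symm, h1.2.1, ?_⟩
    simpa [List.getLast?_reverse] using h3
  · rw [List.nodup_append] at h2 ⊢
    simpa using h2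
  · simpa [List.head?_reverse] using h1.2.2

/-- On a longest path with a shortest possible segment cut off by a chord of the first vertex, a
third neighbour of the first vertex lies beyond the chord. -/
theorem IsChordedPath.exists_adj_tail {V : Type*} {G : SimpleGraph V}
    (hdeg : ∀ v a b, G.Adj v a → ∃ c, G.Adj v c ∧ c ≠ a ∧ c ≠ b) {P R : List V} {z : V}
    (h : G.IsChordedPath P z R)
    (hmax : ∀ l : List V, l.IsChain G.Adj → l.Nodup → l.length ≤ (P ++ z :: R).length)
    (hmin : ∀ P' z' R', G.IsChordedPath P' z' R' →
      (P' ++ z' :: R').length = (P ++ z :: R).length → P.length ≤ P'.length) :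
    ∃ x ∈ P.head?, ∃ y ∈ R, G.Adj x y := by
  obtain ⟨h1, h2, h3, h4⟩ := h
  match P, h4 with
  | x₀ :: x₁ :: P, _ =>
    have h01 : G.Adj x₀ x₁ := by
      simp only [List.cons_append, List.isChain_cons_cons] at h1
      exact h1.1
    obtain ⟨c, hc, hc1, hcz⟩ := hdeg x₀ x₁ z h01
    refine ⟨x₀, rfl, c, ?_, hc⟩
    have hmem : c ∈ (x₀ :: x₁ :: P) ++ z :: R := by
      by_contra hcn
      have := hmax (c :: ((x₀ :: x₁ :: P) ++ z :: R))
        (by simpa [List.isChain_cons_cons] using ⟨hc.symm, by simpa using h1⟩)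
        (List.nodup_cons.2 ⟨hcn, h2⟩)
      simp at this
    have hc0 : c ≠ x₀ := hc.ne'
    simp only [List.mem_append, List.mem_cons, hc0, hc1, hcz, false_or] at hmem
    refine hmem.resolve_left fun hcP => ?_
    obtain ⟨P₁, P₂, rfl⟩ := List.append_of_mem hcP
    have := hmin (x₀ :: x₁ :: P₁) c (P₂ ++ z :: R)
      ⟨by simpa using h1, by simpa using h2, by simpa using hc, by simp⟩ (by simp)
    simp at this

/-- Dirac: a finite graph with an edge, all of whose non-isolated vertices have at least three
neighbours, has a `K₄` minor. With `P ++ z :: R` as in `IsChordedPath.exists_adj_tail`, the branch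
sets are `P` without its last vertex, the last vertex of `P`, the vertex `z`, and `R`. -/
theorem hasMinor_top_four {V : Type*} [Finite V] {G : SimpleGraph V}
    (hdeg : ∀ v a b, G.Adj v a → ∃ c, G.Adj v c ∧ c ≠ a ∧ c ≠ b) {a b : V} (hab : G.Adj a b) :
    G.HasMinor (⊤ : SimpleGraph (Fin 4)) := by
  classical
  have := Fintype.ofFinite V
  -- a longest path
  obtain ⟨N, ⟨l, hlc, hln, hlN⟩, hN⟩ : ∃ N, (∃ l : List V, l.IsChain G.Adj ∧ l.Nodup ∧
      l.length = N) ∧ ∀ l : List V, l.IsChain G.Adj → l.Nodup → l.length ≤ N := by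
    let p : ℕ → Prop := fun n => ∃ l : List V, l.IsChain G.Adj ∧ l.Nodup ∧ l.length = n
    have hp : ∀ n, p n → n ≤ Fintype.card V := by
      rintro n ⟨l, -, hl, rfl⟩
      exact hl.length_le_card
    have hp1 : p 0 := ⟨[], by simp, by simp, rfl⟩
    exact ⟨_, Nat.findGreatest_spec (Nat.zero_le _) hp1, fun l h1 h2 =>
      Nat.le_findGreatest (hp _ ⟨l, h1, h2, rfl⟩) ⟨l, h1, h2, rfl⟩⟩
  have hN2 : 2 ≤ N := hN [a, b] (by simpa using hab) (by simpa using hab.ne)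
  -- a chord at its first vertex
  have hex : ∃ n P z R, G.IsChordedPath P z R ∧ (P ++ z :: R).length = N ∧ P.length = n := by
    match l, hlN ▸ hN2 with
    | x₀ :: x₁ :: l, _ =>
      have h01 : G.Adj x₀ x₁ := by
        rw [List.isChain_cons_cons] at hlc
        exact hlc.1
      obtain ⟨c, hc, hc1, -⟩ := hdeg x₀ x₁ x₁ h01
      have hmem : c ∈ x₀ :: x₁ :: l := by
        by_contra hcn
        have := hN (c :: x₀ :: x₁ :: l) (by rw [List.isChain_cons_cons]; exact ⟨hc.symm, hlc⟩)
          (List.nodup_cons.2 ⟨hcn, hln⟩)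
        simp at this hlN
        omega
      have hc0 : c ≠ x₀ := hc.ne'
      simp only [List.mem_cons, hc0, hc1, false_or] at hmem
      obtain ⟨P, R, rfl⟩ := List.append_of_mem hmem
      exact ⟨_, x₀ :: x₁ :: P, c, R, ⟨by simpa using hlc, by simpa using hln, by simpa using hc,
        by simp⟩, by simpa using hlN, rfl⟩
  obtain ⟨P, z, R, hP, hlen, hPn⟩ := Nat.find_spec hex
  have hmin : ∀ P' z' R', G.IsChordedPath P' z' R' →
      (P' ++ z' :: R').length = (P ++ z :: R).length → P.length ≤ P'.length := by
    intro P' z' R' h h'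
    rw [hPn]
    exact Nat.find_min' hex ⟨P', z', R', h, h'.trans hlen, rfl⟩
  obtain ⟨x, hx, y, hy, hxy⟩ := hP.exists_adj_tail hdeg (fun l h1 h2 => hlen ▸ hN l h1 h2) hmin
  obtain ⟨x', hx', y', hy', hxy'⟩ := hP.reverse.exists_adj_tail hdeg
    (fun l h1 h2 => by simpa [← hlen] using hN l h1 h2) (by simpa using hmin)
  obtain ⟨h1, h2, h3, h4⟩ := hP
  rw [List.head?_reverse] at hx'
  have hPe : P ≠ [] := by rintro rfl; simp at h4
  obtain ⟨Q, t, rfl⟩ : ∃ Q t, P = Q ++ [t] :=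
    ⟨P.dropLast, P.getLast hPe, (List.dropLast_append_getLast hPe).symm⟩
  have ht : x' = t := by simpa [eq_comm] using hx'
  subst ht
  have hQe : Q ≠ [] := by rintro rfl; simp at h4
  have hRe : R ≠ [] := List.ne_nil_of_mem hy
  have hxQ : x ∈ Q := by
    rcases Q with _ | ⟨q, Q⟩
    · exact absurd rfl hQe
    · simp at hx
      simp [hx]
  have hxz : G.Adj x z := h3 x hx
  simp only [List.append_assoc, List.singleton_append] at h1 h2
  rw [List.isChain_append_cons_cons] at h1
  obtain ⟨hc1, htz, hc2⟩ := h1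
  rw [List.isChain_append] at hc1
  obtain ⟨hcQ, -, hQt⟩ := hc1
  rw [List.isChain_cons] at hc2
  have hQl := hQt (Q.getLast hQe) (by simp [List.getLast?_eq_getLast_of_ne_nil hQe]) x' (by simp)
  have hRh := hc2.1 (R.head hRe) (by simp [List.head?_eq_some_head hRe])
  have hQm := List.getLast_mem hQe
  have hRm := List.head_mem hRe
  simp only [List.nodup_append, List.nodup_cons, List.mem_cons, ne_eq] at h2
  have symm : ∀ (A B : Set V), (∃ x ∈ A, ∃ y ∈ B, G.Adj x y) → ∃ x ∈ B, ∃ y ∈ A, G.Adj x y :=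
    fun A B ⟨x, hx, y, hy, h⟩ => ⟨y, hy, x, hx, h.symm⟩
  have e01 : ∃ x ∈ {x | x ∈ Q}, ∃ y ∈ ({x'} : Set V), G.Adj x y := ⟨_, hQm, _, rfl, hQl⟩
  have e02 : ∃ x ∈ {x | x ∈ Q}, ∃ y ∈ ({z} : Set V), G.Adj x y := ⟨_, hxQ, _, rfl, hxz⟩
  have e03 : ∃ x ∈ {x | x ∈ Q}, ∃ y ∈ {x | x ∈ R}, G.Adj x y := ⟨_, hxQ, _, hy, hxy⟩
  have e12 : ∃ x ∈ ({x'} : Set V), ∃ y ∈ ({z} : Set V), G.Adj x y := ⟨_, rfl, _, rfl, htz⟩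
  have e13 : ∃ x ∈ ({x'} : Set V), ∃ y ∈ {x | x ∈ R}, G.Adj x y := ⟨_, rfl, _, hy', hxy'⟩
  have e23 : ∃ x ∈ ({z} : Set V), ∃ y ∈ {x | x ∈ R}, G.Adj x y := ⟨_, rfl, _, hRm, hRh⟩
  have d01 : Disjoint {x | x ∈ Q} ({x'} : Set V) := by
    rw [Set.disjoint_left]; rintro a ha rfl; exact h2.2.2 a ha a (by simp) rfl
  have d02 : Disjoint {x | x ∈ Q} ({z} : Set V) := by
    rw [Set.disjoint_left]; rintro a ha rfl; exact h2.2.2 a ha a (by simp) rfl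
  have d03 : Disjoint {x | x ∈ Q} {x | x ∈ R} := by
    rw [Set.disjoint_left]; intro a ha hb
    exact h2.2.2 a ha a (Or.inr (Or.inr hb)) rfl
  have d12 : Disjoint ({x'} : Set V) ({z} : Set V) := by
    rw [Set.disjoint_left]; rintro a rfl rfl; exact h2.2.1.1 (Or.inl rfl)
  have d13 : Disjoint ({x'} : Set V) {x | x ∈ R} := by
    rw [Set.disjoint_left]; rintro a rfl hb; exact h2.2.1.1 (Or.inr hb)
  have d23 : Disjoint ({z} : Set V) {x | x ∈ R} := by
    rw [Set.disjoint_left]; rintro a rfl hb; exact h2.2.1.2.1 hb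
  have hsing : ∀ v : V, (G.induce ({v} : Set V)).Connected := fun v =>
    SimpleGraph.Connected.mk (by simp)
  refine ⟨![{x | x ∈ Q}, {x'}, {z}, {x | x ∈ R}], ?_, ?_, ?_⟩
  · intro i
    fin_cases i
    · exact connected_induce_of_isChain Q hQe hcQ
    · exact hsing _
    · exact hsing _
    · exact connected_induce_of_isChain R hRe hc2.2
  · intro i j hij
    fin_cases i <;> fin_cases j <;> first
      | exact absurd rfl hij
      | assumption
      | (apply Disjoint.symm; assumption)
  · intro i j hij
    fin_cases i <;> fin_cases j <;> first
      | exact absurd rfl hij.ne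
      | assumption
      | (apply symm; assumption)

end SimpleGraph

/-! ### Combinatorial maps and digons -/

/-- A `5`-regular combinatorial map with darts `D`: `next` turns clockwise around the vertex of a
dart, `rev` passes to the other end of its edge, and every vertex of a dart has five darts, which
`next` permutes cyclically. Points of `V` that carry no dart are ignored. -/
structure FiveMap (D V : Type*) where
  /-- the clockwise successor -/
  next : Equiv.Perm D
  /-- the dart at the other end of the edge -/
  rev : D → D
  /-- the vertex that the dart leaves -/
  vtx : D → V
  rev_rev : ∀ d, rev (rev d) = d
  rev_ne : ∀ d, rev d ≠ d
  vtx_next : ∀ d, vtx (next d) = vtx d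
  next_ne : ∀ d, next d ≠ d
  next_pow : next ^ 5 = 1
  exists_pow : ∀ d d', vtx d = vtx d' → ∃ k < 5, (next ^ k) d = d'

/-- A set with a fixed-point-free involution has an even number of elements. -/
theorem Set.even_ncard_of_involution {α : Type*} [Finite α] {S : Set α} (g : α → α)
    (hS : ∀ a ∈ S, g a ∈ S) (hg : ∀ a, g (g a) = a) (hne : ∀ a, g a ≠ a) : Even S.ncard := by
  classical
  have := Fintype.ofFinite α
  rw [Set.ncard_eq_toFinset_card', ← ZMod.natCast_eq_zero_iff_even]
  have : ∑ a ∈ S.toFinset, (1 : ZMod 2) = 0 :=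
    Finset.sum_involution (fun a _ => g a) (fun _ _ => by decide) (fun a _ _ => hne a)
      (fun a ha => by simpa using hS a (by simpa using ha)) (fun a _ => hg a)
  simpa using this

namespace FiveMap

variable {D V : Type*} (M : FiveMap D V)

/-- The darts that leave `X` along edges to the complement of `X`. -/
def cut (X : Set V) : Set D := {d | M.vtx d ∈ X ∧ M.vtx (M.rev d) ∉ X}

/-- No edge cut has size `1` or `3`. As `|δ(X)| ≡ 5|X| ≡ |X|` modulo `2` in a `5`-regular graph,
this says that odd sets have at least five boundary edges. -/
def OddCut : Prop := ∀ X, (M.cut X).ncard ≠ 1 ∧ (M.cut X).ncard ≠ 3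

/-- Planarity in the form of a Jordan curve theorem: for every edge set `C` with an even number of
edges at each vertex, the faces can be `2`-coloured so that `C` is the set of edges whose two sides
have different colours. The colour `s d` is that of the face between `next⁻¹ d` and `d`. -/
def Jordan : Prop := ∀ C : D → ZMod 2, (∀ d, C (M.rev d) = C d) →
  (∀ d, ∑ k ∈ Finset.range 5, C ((M.next ^ k) d) = 0) →
  ∃ s : D → ZMod 2, ∀ d, s (M.next d) = s (M.rev d) ∧ s d + s (M.rev d) = C d

/-- The underlying simple graph. -/
def graph : SimpleGraph V where
  Adj x y := x ≠ y ∧ ∃ d, M.vtx d = x ∧ M.vtx (M.rev d) = y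
  symm := ⟨by
    rintro x y ⟨h, d, rfl, rfl⟩
    exact ⟨h.symm, M.rev d, rfl, by rw [M.rev_rev]⟩⟩
  loopless := ⟨fun _ h => h.1 rfl⟩

theorem rev_injective : Function.Injective M.rev :=
  Function.LeftInverse.injective M.rev_rev

theorem vtx_pow (k : ℕ) (d : D) : M.vtx ((M.next ^ k) d) = M.vtx d := by
  induction k with
  | zero => rfl
  | succ k ih => rw [pow_succ', Equiv.Perm.mul_apply, M.vtx_next, ih]

theorem vtx_zpow (k : ℤ) (d : D) : M.vtx ((M.next ^ k) d) = M.vtx d := by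
  cases k with
  | ofNat k => simpa using M.vtx_pow k d
  | negSucc k =>
    rw [zpow_negSucc, ← M.vtx_pow (k + 1), Equiv.Perm.coe_inv, Equiv.apply_symm_apply]

theorem pow_ne {k : ℕ} (h0 : 0 < k) (h5 : k < 5) (d : D) : (M.next ^ k) d ≠ d := by
  intro h
  have h1 : Function.IsPeriodicPt M.next 5 d := by
    rw [Function.IsPeriodicPt, Function.IsFixedPt, ← Equiv.Perm.coe_pow, M.next_pow]; rfl
  have h2 : Function.IsPeriodicPt M.next k d := by
    rw [Function.IsPeriodicPt, Function.IsFixedPt, ← Equiv.Perm.coe_pow]; exact h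
  have h3 := h1.gcd h2
  have h4 : Nat.gcd 5 k = 1 := by interval_cases k <;> rfl
  rw [h4] at h3
  exact M.next_ne d h3

theorem pow_injOn (d : D) {k l : ℕ} (hk : k < 5) (hl : l < 5)
    (h : (M.next ^ k) d = (M.next ^ l) d) : k = l := by
  wlog hkl : k ≤ l generalizing k l
  · exact (this hl hk h.symm (by omega)).symm
  obtain ⟨m, rfl⟩ := Nat.exists_eq_add_of_le hkl
  rw [pow_add, Equiv.Perm.mul_apply] at h
  by_contra hne
  exact M.pow_ne (k := m) (by omega) (by omega) d ((M.next ^ k).injective h).symm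

theorem zpow_emod (k : ℤ) : M.next ^ (k % 5) = M.next ^ k := by
  conv_rhs => rw [← Int.emod_add_mul_ediv k 5, zpow_add, zpow_mul]
  have : M.next ^ (5 : ℤ) = 1 := by exact_mod_cast M.next_pow
  rw [this, one_zpow, mul_one]

theorem zpow_eq_pow (k : ℤ) : M.next ^ k = M.next ^ (k % 5).toNat := by
  rw [← zpow_natCast, Int.toNat_of_nonneg (Int.emod_nonneg _ (by norm_num)), M.zpow_emod]

theorem zpow_eq_zpow_iff (d : D) (k l : ℤ) :
    (M.next ^ k) d = (M.next ^ l) d ↔ k % 5 = l % 5 := by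
  constructor
  · intro h
    rw [M.zpow_eq_pow k, M.zpow_eq_pow l] at h
    have := M.pow_injOn d (by omega) (by omega) h
    omega
  · intro h
    rw [← M.zpow_emod k, h, M.zpow_emod]

/-- The indicator function of a dart, summed over the darts at a vertex. -/
theorem sum_indicator [DecidableEq D] [DecidableEq V] (e d : D) :
    ∑ k ∈ Finset.range 5, (if (M.next ^ k) d = e then (1 : ZMod 2) else 0) =
      if M.vtx d = M.vtx e then 1 else 0 := by
  split_ifs with h
  · obtain ⟨k, hk, rfl⟩ := M.exists_pow d e h
    rw [Finset.sum_eq_single_of_mem k (by simpa using hk), if_pos rfl]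
    intro l hl hne
    rw [if_neg]
    exact fun h => hne (M.pow_injOn d (by simpa using hl) hk h)
  · refine Finset.sum_eq_zero fun k _ => if_neg ?_
    rintro rfl
    exact h (M.vtx_pow k d).symm

variable {M}

theorem ncard_cut_compl (X : Set V) : (M.cut Xᶜ).ncard = (M.cut X).ncard := by
  have : M.cut Xᶜ = M.rev '' M.cut X := by
    ext d
    constructor
    · rintro ⟨h1, h2⟩
      exact ⟨M.rev d, ⟨by simpa using h2, by simpa [M.rev_rev] using h1⟩, M.rev_rev d⟩
    · rintro ⟨d, ⟨h1, h2⟩, rfl⟩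
      exact ⟨by simpa using h2, by simpa [M.rev_rev] using h1⟩
  rw [this, Set.ncard_image_of_injective _ M.rev_injective]

theorem setOf_vtx_eq (d : D) :
    {d' | M.vtx d' = M.vtx d} = (fun k => (M.next ^ k) d) '' (Finset.range 5 : Set ℕ) := by
  ext d'
  simp only [Set.mem_ofPred_eq, Set.mem_image, Finset.coe_range, Set.mem_Iio]
  constructor
  · intro h
    exact M.exists_pow d d' h.symm
  · rintro ⟨k, -, rfl⟩
    exact M.vtx_pow k d

theorem ncard_vtx_eq (d : D) : {d' | M.vtx d' = M.vtx d}.ncard = 5 := by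
  rw [setOf_vtx_eq, Set.InjOn.ncard_image fun k hk l hl h =>
    M.pow_injOn d (by simpa using hk) (by simpa using hl) h, Set.ncard_coe_finset,
    Finset.card_range]

/-- A vertex with loops would have only one or three boundary edges. -/
theorem OddCut.vtx_rev_ne [Finite D] (hM : M.OddCut) (d : D) : M.vtx (M.rev d) ≠ M.vtx d := by
  intro h
  have h5 := ncard_vtx_eq (M := M) d
  set L := {d' | M.vtx d' = M.vtx d ∧ M.vtx (M.rev d') = M.vtx d}
  have hu : {d' | M.vtx d' = M.vtx d} = L ∪ M.cut {M.vtx d} := by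
    ext d'
    simp only [L, cut, Set.mem_union, Set.mem_ofPred_eq, Set.mem_singleton_iff]
    tauto
  have hd : Disjoint L (M.cut {M.vtx d}) := by
    rw [Set.disjoint_left]
    rintro d' ⟨-, h1⟩ ⟨-, h2⟩
    exact h2 h1
  rw [hu, Set.ncard_union_eq hd] at h5
  have hL : Even L.ncard := Set.even_ncard_of_involution M.rev
    (fun a ha => ⟨ha.2, by rw [M.rev_rev]; exact ha.1⟩) M.rev_rev M.rev_ne
  have hpos : 0 < L.ncard := (Set.ncard_pos).2 ⟨d, rfl, h⟩
  have := hM {M.vtx d}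
  obtain ⟨m, hm⟩ := hL
  omega

/-- A `2`-colouring of the faces that separates the two sides of the closed curve formed by two
parallel edges. -/
theorem Jordan.exists_digon (hJ : M.Jordan) {e e' : D} (h1 : M.vtx e' = M.vtx e)
    (h2 : M.vtx (M.rev e') = M.vtx (M.rev e)) (hne : e' ≠ e) (hl : M.vtx (M.rev e) ≠ M.vtx e) :
    ∃ s : D → ZMod 2, (∀ d, s (M.next d) = s (M.rev d)) ∧
      s (M.next e) = s e + 1 ∧ s (M.next e') = s e' + 1 ∧
      s (M.next (M.rev e)) = s (M.rev e) + 1 ∧ s (M.next (M.rev e')) = s (M.rev e') + 1 ∧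
      ∀ d, d ≠ e → d ≠ e' → d ≠ M.rev e → d ≠ M.rev e' → s (M.next d) = s d := by
  classical
  obtain ⟨s, hs⟩ := hJ (fun d => ((if d = e then 1 else 0) + (if d = M.rev e then 1 else 0)) +
    ((if d = e' then 1 else 0) + (if d = M.rev e' then 1 else 0)))
    (fun d => by
      have h (a : D) : M.rev d = a ↔ d = M.rev a :=
        ⟨fun h => by rw [← h, M.rev_rev], fun h => by rw [h, M.rev_rev]⟩
      simp only [h, M.rev_rev]
      ring)
    (fun d => by
      simp only [Finset.sum_add_distrib, sum_indicator, h1, h2]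
      exact CharTwo.add_self_eq_zero _)
  have hr : ∀ a, M.rev a = e ↔ a = M.rev e := fun a =>
    ⟨fun h => by rw [← h, M.rev_rev], fun h => by rw [h, M.rev_rev]⟩
  have hstep : ∀ d, s (M.next d) = s d + (((if d = e then 1 else 0) +
      (if d = M.rev e then 1 else 0)) + ((if d = e' then 1 else 0) +
      (if d = M.rev e' then 1 else 0))) := by
    intro d
    rw [← (hs d).2, (hs d).1, ← add_assoc, CharTwo.add_self_eq_zero, zero_add]
  have n1 : e ≠ M.rev e := fun h => hl (by rw [← h])
  have n2 : e ≠ M.rev e' := fun h => hl (by rw [← h2, ← h])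
  have n3 : e' ≠ M.rev e := fun h => hl (by rw [← h, h1])
  have n4 : e' ≠ M.rev e' := fun h => hl (by rw [← h2, ← h, h1])
  have n5 : M.rev e' ≠ M.rev e := fun h => hne (M.rev_injective h)
  refine ⟨s, fun d => (hs d).1, ?_, ?_, ?_, ?_, ?_⟩
  · rw [hstep]; simp [n1, n2, hne.symm]
  · rw [hstep]; simp [n3, n4, hne]
  · rw [hstep]; simp [n1.symm, n3.symm, n5.symm]
  · rw [hstep]; simp [n2.symm, n4.symm, n5]
  · intro d a b c f
    rw [hstep]; simp [a, b, c, f]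

theorem apply_pow_of_const {s : D → ZMod 2} {x : V} (h : ∀ d, M.vtx d = x → s (M.next d) = s d)
    {d d' : D} (hd : M.vtx d = x) (hd' : M.vtx d' = x) : s d' = s d := by
  obtain ⟨k, -, rfl⟩ := M.exists_pow d d' (hd.trans hd'.symm)
  clear hd'
  induction k with
  | zero => rfl
  | succ k ih => rw [pow_succ', Equiv.Perm.mul_apply, h _ (by rw [M.vtx_pow, hd]), ih]

/-- Edges to two different neighbours do not alternate around a vertex. -/
theorem Jordan.not_alternate (hJ : M.Jordan) {e : D}
    (hu : M.vtx (M.rev ((M.next ^ 2) e)) = M.vtx (M.rev e))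
    (hw : M.vtx (M.rev ((M.next ^ 3) e)) = M.vtx (M.rev (M.next e)))
    (h1 : M.vtx (M.rev e) ≠ M.vtx e) (h2 : M.vtx (M.rev (M.next e)) ≠ M.vtx e) :
    M.vtx (M.rev (M.next e)) = M.vtx (M.rev e) := by
  by_contra hne
  obtain ⟨s, hs, -, hs2, -, -, hs5⟩ := hJ.exists_digon (e := e) (e' := (M.next ^ 2) e)
    (M.vtx_pow 2 e) hu (M.pow_ne (by norm_num) (by norm_num) e) h1
  have hconst : ∀ d, M.vtx d = M.vtx (M.rev (M.next e)) → s (M.next d) = s d := by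
    intro d hd
    refine hs5 d ?_ ?_ ?_ ?_
    · rintro rfl; exact h2 hd.symm
    · rintro rfl; exact h2 (by rw [← hd, M.vtx_pow])
    · rintro rfl; exact hne hd.symm
    · rintro rfl; exact hne (by rw [← hd, hu])
  have hA := apply_pow_of_const hconst rfl hw
  rw [← hs, ← hs] at hA
  have e2 : M.next (M.next e) = (M.next ^ 2) e := rfl
  have e3 : M.next ((M.next ^ 2) e) = (M.next ^ 3) e := rfl
  -- the two edges to the second neighbour lie on different sides of the closed curve
  have hB : s (M.next ((M.next ^ 3) e)) = s ((M.next ^ 3) e) := by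
    refine hs5 _ (M.pow_ne (by norm_num) (by norm_num) e) ?_ ?_ ?_
    · intro h; simpa using M.pow_injOn e (by norm_num) (by norm_num) h
    · intro h; exact h1 (by rw [← h, M.vtx_pow])
    · intro h; exact h1 (by rw [← hu, ← h, M.vtx_pow])
  rw [hB, ← e3, hs2, e2] at hA
  simp at hA

/-- In a plane `5`-graph, two parallel edges that are consecutive at one end are consecutive, in
the reverse order, at the other end. Otherwise the part of the graph inside the digon is attached
to the rest only at this other end, and it, or its union with this end, has one or three boundary
edges. -/
theorem Jordan.next_rev_next [Finite D] (hJ : M.Jordan) (hM : M.OddCut) {e : D}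
    (h : M.vtx (M.rev (M.next e)) = M.vtx (M.rev e)) : M.next (M.rev (M.next e)) = M.rev e := by
  have hl := hM.vtx_rev_ne e
  obtain ⟨s, hs, -, hs2, hs3, hs4, hs5⟩ := hJ.exists_digon (e := e) (e' := M.next e)
    (M.vtx_next e) h (M.next_ne e) hl
  set y := M.rev e with hy
  set v := M.vtx e with hv
  set z := M.vtx y with hz
  have hrev : ∀ a b, M.rev a = b ↔ a = M.rev b := fun a b =>
    ⟨fun h => by rw [← h, M.rev_rev], fun h => by rw [h, M.rev_rev]⟩
  have hye : M.rev y = e := M.rev_rev e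
  -- away from the digon the colour of the faces around a vertex is constant
  have hconst : ∀ x, x ≠ v → x ≠ z → ∀ d, M.vtx d = x → s (M.next d) = s d := by
    rintro _ hxv hxz d rfl
    refine hs5 d ?_ ?_ ?_ ?_
    · rintro rfl; exact hxv rfl
    · rintro rfl; exact hxv (M.vtx_next e)
    · rintro rfl; exact hxz rfl
    · rintro rfl; exact hxz h
  have hc : s y = s (M.next e) := (hs e).symm
  -- every other dart at `v` lies outside the digon
  have hv_out : ∀ d, M.vtx d = v → d ≠ e → d ≠ M.next e → s d ≠ s (M.next e) := by
    intro d hd hde hde'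
    have hfix : ∀ k, 2 ≤ k → k < 5 → s (M.next ((M.next ^ k) e)) = s ((M.next ^ k) e) := by
      intro k hk hk5
      refine hs5 _ (M.pow_ne (by omega) hk5 e) ?_ ?_ ?_
      · intro h'
        have := M.pow_injOn e (l := 1) hk5 (by norm_num) (by simpa using h')
        omega
      · intro h'; exact hl (by rw [hz, ← h', M.vtx_pow])
      · intro h'; exact hl (by rw [← h, ← h', M.vtx_pow])
    have hs0 : s (M.next (M.next e)) = s (M.next e) + 1 := hs2
    obtain ⟨k, hk, rfl⟩ := M.exists_pow e d hd.symm
    have h2 : s ((M.next ^ 2) e) = s (M.next e) + 1 := hs0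
    have h3 : s ((M.next ^ 3) e) = s (M.next e) + 1 := by
      rw [← h2, ← hfix 2 (by norm_num) (by norm_num)]; rfl
    have h4 : s ((M.next ^ 4) e) = s (M.next e) + 1 := by
      rw [← h3, ← hfix 3 (by norm_num) (by norm_num)]; rfl
    interval_cases k
    · exact absurd rfl hde
    · exact absurd rfl hde'
    · rw [h2]; simp
    · rw [h3]; simp
    · rw [h4]; simp
  -- the vertices inside the digon
  set X : Set V := {x | x ≠ v ∧ x ≠ z ∧ ∃ d, M.vtx d = x ∧ s d = s (M.next e)} with hX
  have hXs : ∀ d, M.vtx d ∈ X → s d = s (M.next e) := by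
    rintro d ⟨h1, h2, d', h3, h4⟩
    rw [← h4]
    exact apply_pow_of_const (hconst _ h1 h2) h3 rfl
  obtain ⟨j, hj, hjy⟩ := M.exists_pow y (M.rev (M.next e)) h.symm
  have hj0 : j ≠ 0 := by
    rintro rfl
    exact M.next_ne e (M.rev_injective hjy.symm)
  have hzd : ∀ k < 5, k ≠ 0 → k ≠ j → s (M.next ((M.next ^ k) y)) = s ((M.next ^ k) y) := by
    intro k hk hk0 hkj
    refine hs5 _ ?_ ?_ (M.pow_ne (by omega) hk y) ?_
    · intro h'; exact hl (by rw [hz, ← M.vtx_pow k y, h'])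
    · intro h'; exact hl (by rw [hz, ← M.vtx_pow k y, h', M.vtx_next])
    · rw [← hjy]; intro h'; exact hkj (M.pow_injOn y hk hj h')
  have hzj : s (M.next ((M.next ^ j) y)) = s ((M.next ^ j) y) + 1 := by rw [hjy]; exact hs4
  have hz1 : s ((M.next ^ 1) y) = s (M.next e) + 1 := by rw [← hc]; exact hs3
  have hnp : ∀ k, M.next ((M.next ^ k) y) = (M.next ^ (k + 1)) y := fun k => by
    rw [pow_succ', Equiv.Perm.mul_apply]
  have hzX : z ∉ X := fun h => h.2.1 rfl
  -- a dart at `z` leads into `X` exactly if it lies inside the digon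
  have hmem : ∀ k < 5, k ≠ 0 → k ≠ j →
      (M.vtx (M.rev ((M.next ^ k) y)) ∈ X ↔ s ((M.next ^ k) y) = s (M.next e)) := by
    intro k hk hk0 hkj
    have hsr : s (M.rev ((M.next ^ k) y)) = s ((M.next ^ k) y) := by
      rw [← hs, hzd k hk hk0 hkj]
    constructor
    · intro hx
      rw [← hsr, hXs _ hx]
    · intro hx
      refine ⟨fun hxv => ?_, fun hxz => ?_, _, rfl, hsr.trans hx⟩
      · refine hv_out _ hxv ?_ ?_ (hsr.trans hx)
        · rw [Ne, hrev]; exact M.pow_ne (by omega) hk y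
        · rw [Ne, hrev, ← hjy]; intro h'; exact hkj (M.pow_injOn y hk hj h')
      · exact hM.vtx_rev_ne _ (by rw [hxz, M.vtx_pow])
  have hvX : v ∉ X := fun h => h.1 rfl
  have hr0 : M.vtx (M.rev ((M.next ^ 0) y)) ∉ X := by
    rw [show (M.next ^ 0) y = y from rfl, hye]; exact hvX
  have hrj : M.vtx (M.rev ((M.next ^ j) y)) ∉ X := by
    rw [hjy, M.rev_rev, M.vtx_next]; exact hvX
  -- edges that leave `X` go to `z`
  have hXz : ∀ d, M.vtx d ∈ X → M.vtx (M.rev d) ∉ X → M.vtx (M.rev d) = z := by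
    intro d hd hrd
    by_contra hne
    have hsd := hXs d hd
    have hsr : s (M.rev d) = s (M.next e) := by
      rw [← hs, hconst _ hd.1 hd.2.1 d rfl, hsd]
    refine hrd ⟨fun hrv => ?_, hne, _, rfl, hsr⟩
    refine hv_out _ hrv ?_ ?_ hsr
    · rw [Ne, hrev]; rintro rfl; exact hzX hd
    · rw [Ne, hrev]; rintro rfl; exact hzX (h ▸ hd)
  have hcutX : M.cut Xᶜ = {d | ∃ k < 5, d = (M.next ^ k) y ∧ M.vtx (M.rev d) ∈ X} := by
    ext d
    constructor
    · rintro ⟨h1, h2⟩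
      have h2 := not_not.1 h2
      have h3 := hXz _ h2 (by rwa [M.rev_rev])
      rw [M.rev_rev] at h3
      obtain ⟨k, hk, rfl⟩ := M.exists_pow y d h3.symm
      exact ⟨k, hk, rfl, h2⟩
    · rintro ⟨k, hk, rfl, h1⟩
      refine ⟨?_, not_not.2 h1⟩
      rw [M.vtx_pow]
      exact hzX
  have hcutY : M.cut (insert z X) = {d | ∃ k < 5, d = (M.next ^ k) y ∧ M.vtx (M.rev d) ∉ X} := by
    ext d
    constructor
    · rintro ⟨h1, h2⟩
      rw [Set.mem_insert_iff, not_or] at h2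
      rcases h1 with h1 | h1
      · obtain ⟨k, hk, rfl⟩ := M.exists_pow y d h1.symm
        exact ⟨k, hk, rfl, h2.2⟩
      · exact absurd (hXz _ h1 h2.2) h2.1
    · rintro ⟨k, hk, rfl, h1⟩
      refine ⟨Or.inl (M.vtx_pow k y), ?_⟩
      rw [Set.mem_insert_iff, not_or]
      refine ⟨fun h' => ?_, h1⟩
      exact hM.vtx_rev_ne _ (h'.trans (M.vtx_pow k y).symm)
  have hcard : ∀ (A : Finset ℕ), (∀ k ∈ A, k < 5) →
      {d | ∃ k ∈ A, d = (M.next ^ k) y}.ncard = A.card := by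
    intro A hA
    have : {d | ∃ k ∈ A, d = (M.next ^ k) y} = (fun k => (M.next ^ k) y) '' (A : Set ℕ) := by
      ext d; simp [eq_comm]
    rw [this, Set.InjOn.ncard_image fun k hk l hl h' => M.pow_injOn y (hA k hk) (hA l hl) h',
      Set.ncard_coe_finset]
  have hlt : ∀ k < 5, k ≠ 0 → k ≤ j → s ((M.next ^ k) y) = s (M.next e) + 1 := by
    intro k
    induction k with
    | zero => intro _ h0; exact absurd rfl h0
    | succ k ih =>
      intro hk _ hkj
      rcases Nat.eq_zero_or_pos k with rfl | hk0
      · exact hz1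
      · rw [← hnp, hzd k (by omega) (by omega) (by omega), ih (by omega) (by omega) (by omega)]
  have hgt : ∀ k < 5, j < k → s ((M.next ^ k) y) = s (M.next e) := by
    intro k
    induction k with
    | zero => intro _ h0; omega
    | succ k ih =>
      intro hk hkj
      rcases Nat.lt_succ_iff_lt_or_eq.1 hkj with h' | rfl
      · rw [← hnp, hzd k (by omega) (by omega) (by omega), ih (by omega) h']
      · rw [← hnp, hzj, hlt j hj hj0 le_rfl, add_assoc, CharTwo.add_self_eq_zero, add_zero]
  have hmemX : ∀ k < 5, (M.vtx (M.rev ((M.next ^ k) y)) ∈ X ↔ j < k) := by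
    intro k hk
    rcases eq_or_ne k 0 with rfl | hk0
    · simpa using hr0
    rcases eq_or_ne k j with rfl | hkj
    · simpa using hrj
    rw [hmem k hk hk0 hkj]
    constructor
    · intro h'
      by_contra hlt'
      rw [hlt k hk hk0 (by omega)] at h'
      simp at h'
    · exact hgt k hk
  have hXcard : (M.cut Xᶜ).ncard = (Finset.filter (fun k => j < k) (Finset.range 5)).card := by
    rw [hcutX, ← hcard _ (fun k hk => by simpa using (Finset.mem_filter.1 hk).1)]
    congr 1
    ext d
    simp only [Set.mem_ofPred_eq, Finset.mem_filter, Finset.mem_range]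
    constructor
    · rintro ⟨k, hk, rfl, h'⟩
      exact ⟨k, ⟨hk, (hmemX k hk).1 h'⟩, rfl⟩
    · rintro ⟨k, ⟨hk, h'⟩, rfl⟩
      exact ⟨k, hk, rfl, (hmemX k hk).2 h'⟩
  have hYcard : (M.cut (insert z X)).ncard =
      (Finset.filter (fun k => ¬ j < k) (Finset.range 5)).card := by
    rw [hcutY, ← hcard _ (fun k hk => by simpa using (Finset.mem_filter.1 hk).1)]
    congr 1
    ext d
    simp only [Set.mem_ofPred_eq, Finset.mem_filter, Finset.mem_range]
    constructor
    · rintro ⟨k, hk, rfl, h'⟩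
      exact ⟨k, ⟨hk, fun h => h' ((hmemX k hk).2 h)⟩, rfl⟩
    · rintro ⟨k, ⟨hk, h'⟩, rfl⟩
      exact ⟨k, hk, rfl, fun h => h' ((hmemX k hk).1 h)⟩
  have cX := hM Xᶜ
  have cY := hM (insert z X)
  rw [hXcard] at cX
  rw [hYcard] at cY
  -- the number `4 - j` of darts inside the digon is `0`
  have hj4 : j = 4 := by
    clear * - hj hj0 cX cY
    interval_cases j
    · exact absurd rfl hj0
    · exact absurd (by decide) cX.2
    · exact absurd (by decide) cY.2
    · exact absurd (by decide) cX.1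
    · rfl
  rw [← hjy, hj4, hnp, M.next_pow]
  rfl

end FiveMap

/-! ### Reducible configurations -/

namespace FiveMap

variable {D V : Type*} {M : FiveMap D V}

/-- The dart `d` leaves `u` or `v`. -/
def At (M : FiveMap D V) (u v : V) (d : D) : Prop := M.vtx d = u ∨ M.vtx d = v

/-- A reducible configuration: two vertices `u` and `v` with at least three common edges, where all
edges at `v` go to `u` or `w`. The map `τ` is the reflection that interchanges the rotations at `u`
and `v`, and it interchanges the two ends of every edge between `u` and `v`. The three edges from
`e` on go from `v` to `u`; the last two may go elsewhere, and if both do, they are consecutive at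
`w` too. -/
structure IsMirror (M : FiveMap D V) (u v w : V) (e : D) (τ : D → D) : Prop where
  ne : u ≠ v
  vtx_base : M.vtx e = v
  vtx_rev_base : M.vtx (M.rev e) = u
  vtx_rev_one : M.vtx (M.rev (M.next e)) = u
  vtx_rev_two : M.vtx (M.rev ((M.next ^ 2) e)) = u
  next_rev_four : ¬ M.At u v (M.rev ((M.next ^ 3) e)) → ¬ M.At u v (M.rev ((M.next ^ 4) e)) →
    M.next (M.rev ((M.next ^ 4) e)) = M.rev ((M.next ^ 3) e)
  map_base : τ e = M.rev e
  vtx_left : ∀ d, M.vtx d = u → M.vtx (τ d) = v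
  vtx_right : ∀ d, M.vtx d = v → M.vtx (τ d) = u
  invol : ∀ d, M.At u v d → τ (τ d) = d
  map_next : ∀ d, M.At u v d → M.next (τ (M.next d)) = τ d
  map_eq_rev : ∀ d, M.At u v d → M.At u v (M.rev d) → τ d = M.rev d
  vtx_rev_of_not : ∀ d, M.vtx d = v → ¬ M.At u v (M.rev d) → M.vtx (M.rev d) = w

theorem at_next {u v : V} {d : D} : M.At u v (M.next d) ↔ M.At u v d := by
  rw [At, At, M.vtx_next]

theorem exists_reflection {e y : D} (h : M.vtx y ≠ M.vtx e) : ∃ τ : D → D, ∀ k : ℤ,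
    τ ((M.next ^ k) e) = (M.next ^ (-k)) y ∧ τ ((M.next ^ k) y) = (M.next ^ (-k)) e := by
  classical
  have hmod : ∀ (k l : ℤ) (a b : D), (M.next ^ k) a = (M.next ^ l) a →
      (M.next ^ (-k)) b = (M.next ^ (-l)) b := by
    intro k l a b hkl
    rw [M.zpow_eq_zpow_iff] at hkl ⊢
    omega
  refine ⟨fun d => if h : ∃ k : ℤ, (M.next ^ k) e = d then (M.next ^ (-h.choose)) y else
    if h : ∃ k : ℤ, (M.next ^ k) y = d then (M.next ^ (-h.choose)) e else d, fun k => ⟨?_, ?_⟩⟩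
  · have hk : ∃ l : ℤ, (M.next ^ l) e = (M.next ^ k) e := ⟨k, rfl⟩
    beta_reduce
    rw [dif_pos hk]
    exact hmod _ _ _ _ hk.choose_spec
  · have hk : ∃ l : ℤ, (M.next ^ l) y = (M.next ^ k) y := ⟨k, rfl⟩
    beta_reduce
    rw [dif_neg, dif_pos hk]
    · exact hmod _ _ _ _ hk.choose_spec
    · rintro ⟨l, hl⟩
      apply h
      rw [← M.vtx_zpow k y, ← hl, M.vtx_zpow]

theorem exists_zpow {d d' : D} (h : M.vtx d' = M.vtx d) : ∃ k : ℤ, d' = (M.next ^ k) d := by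
  obtain ⟨k, -, hk⟩ := M.exists_pow d d' h.symm
  exact ⟨k, by rw [zpow_natCast, hk]⟩

/-- A vertex with at most two neighbours gives a reducible configuration. -/
theorem exists_isMirror_of_neighbours [Finite D] (hM : M.OddCut) (hJ : M.Jordan) {u w : V} {e : D}
    (h0 : M.vtx (M.rev e) = u) (h1 : M.vtx (M.rev (M.next e)) = u)
    (h2 : M.vtx (M.rev ((M.next ^ 2) e)) = u)
    (hN : ∀ d, M.vtx d = M.vtx e → M.vtx (M.rev d) = u ∨ M.vtx (M.rev d) = w) :
    ∃ τ, M.IsMirror u (M.vtx e) w e τ := by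
  have huv : u ≠ M.vtx e := h0 ▸ hM.vtx_rev_ne e
  obtain ⟨τ, hτ⟩ := exists_reflection (M := M) (e := e) (y := M.rev e) (by rwa [h0])
  have hstep : ∀ k : ℕ, M.vtx (M.rev ((M.next ^ (k + 1)) e)) = M.vtx (M.rev ((M.next ^ k) e)) →
      M.next (M.rev ((M.next ^ (k + 1)) e)) = M.rev ((M.next ^ k) e) := by
    intro k hk
    rw [pow_succ', Equiv.Perm.mul_apply] at hk ⊢
    exact hJ.next_rev_next hM hk
  have hneg : ∀ (k : ℕ) (d : D), M.next d = (M.next ^ (-(k : ℤ))) (M.rev e) →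
      d = (M.next ^ (-((k + 1 : ℕ) : ℤ))) (M.rev e) := by
    intro k d hd
    apply M.next.injective
    rw [hd, ← Equiv.Perm.mul_apply, ← zpow_one_add]
    congr 2
    push_cast
    ring
  have e1 : M.rev ((M.next ^ 1) e) = (M.next ^ (-((1 : ℕ) : ℤ))) (M.rev e) :=
    hneg 0 _ (hstep 0 (by exact h1.trans h0.symm))
  have e2 : M.rev ((M.next ^ 2) e) = (M.next ^ (-((2 : ℕ) : ℤ))) (M.rev e) :=
    hneg 1 _ ((hstep 1 (by exact h2.trans h1.symm)).trans e1)
  -- the edges to `u` are consecutive, and the reflection interchanges their ends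
  have hpar : ∀ k : ℕ, k < 5 → M.vtx (M.rev ((M.next ^ k) e)) = u →
      M.rev ((M.next ^ k) e) = (M.next ^ (-(k : ℤ))) (M.rev e) := by
    intro k hk hku
    interval_cases k
    · simp
    · exact e1
    · exact e2
    · exact hneg 2 _ ((hstep 2 (hku.trans h2.symm)).trans e2)
    · have h5 : (M.next ^ (4 + 1)) e = e := by rw [M.next_pow]; rfl
      rw [← hstep 4 (by rw [h5, h0, hku]), h5]
      change (M.next ^ (1 : ℤ)) (M.rev e) = _
      rw [M.zpow_eq_zpow_iff]
      rfl
  have hmap : ∀ d, M.vtx d = M.vtx e → M.vtx (M.rev d) = u → τ d = M.rev d := by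
    intro d hd hdu
    obtain ⟨k, hk, rfl⟩ := M.exists_pow e d hd.symm
    rw [hpar k hk hdu, ← (hτ k).1, zpow_natCast]
  refine ⟨τ, huv, rfl, h0, h1, h2, ?_, ?_, ?_, ?_, ?_, ?_, ?_, ?_⟩
  · intro h3 h4
    have h3 := (hN _ (M.vtx_pow 3 e)).resolve_left fun h => h3 (Or.inl h)
    have h4 := (hN _ (M.vtx_pow 4 e)).resolve_left fun h => h4 (Or.inl h)
    exact hstep 3 (h4.trans h3.symm)
  · exact hmap e rfl h0
  · rintro d hd
    obtain ⟨k, rfl⟩ := exists_zpow (hd.trans h0.symm)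
    rw [(hτ k).2, M.vtx_zpow]
  · rintro d hd
    obtain ⟨k, rfl⟩ := exists_zpow hd
    rw [(hτ k).1, M.vtx_zpow, h0]
  · rintro d (hd | hd)
    · obtain ⟨k, rfl⟩ := exists_zpow (hd.trans h0.symm)
      rw [(hτ k).2, (hτ _).1, neg_neg]
    · obtain ⟨k, rfl⟩ := exists_zpow hd
      rw [(hτ k).1, (hτ _).2, neg_neg]
  · have hn : ∀ (k : ℤ) (d : D), M.next ((M.next ^ k) d) = (M.next ^ (1 + k)) d := fun k d => by
      rw [zpow_one_add, Equiv.Perm.mul_apply]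
    rintro d (hd | hd)
    · obtain ⟨k, rfl⟩ := exists_zpow (hd.trans h0.symm)
      rw [hn, (hτ _).2, (hτ _).2, hn]
      congr 2
      ring
    · obtain ⟨k, rfl⟩ := exists_zpow hd
      rw [hn, (hτ _).1, (hτ _).1, hn]
      congr 2
      ring
  · rintro d (hd | hd) (hr | hr)
    · exact absurd (hr.trans hd.symm) (hM.vtx_rev_ne d)
    · have h' := hmap (M.rev d) hr (by rw [M.rev_rev, hd])
      obtain ⟨k, hk⟩ := exists_zpow hr
      have h'' : τ (τ (M.rev d)) = M.rev d := by
        rw [hk, (hτ k).1, (hτ _).2, neg_neg]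
      rw [h', M.rev_rev] at h''
      exact h''
    · exact hmap d hd hr
    · exact absurd (hr.trans hd.symm) (hM.vtx_rev_ne d)
  · intro d hd hr
    exact (hN d hd).resolve_left fun h => hr (Or.inl h)

theorem exists_isMirror [Finite D] [Finite V] [Nonempty D] (hM : M.OddCut) (hJ : M.Jordan)
    (hK : ¬ M.graph.HasMinor (⊤ : SimpleGraph (Fin 4))) :
    ∃ u v w e τ, M.IsMirror u v w e τ := by
  obtain ⟨v, a, b, ⟨-, d, rfl, -⟩, hN⟩ :
      ∃ v a b, M.graph.Adj v a ∧ ∀ c, M.graph.Adj v c → c = a ∨ c = b := by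
    by_contra! hcon
    obtain ⟨d⟩ := ‹Nonempty D›
    have hd : M.graph.Adj (M.vtx d) (M.vtx (M.rev d)) :=
      ⟨(hM.vtx_rev_ne d).symm, d, rfl, rfl⟩
    exact hK (SimpleGraph.hasMinor_top_four hcon hd)
  have hN' : ∀ d', M.vtx d' = M.vtx d → M.vtx (M.rev d') = a ∨ M.vtx (M.rev d') = b :=
    fun d' hd' => hN _ ⟨hd' ▸ (hM.vtx_rev_ne d').symm, d', hd', rfl⟩
  have hcyc : ∀ χ : Fin 5 → Bool, (∃ i, χ (i + 1) = χ i ∧ χ (i + 2) = χ i) ∨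
      ∃ i, χ (i + 2) = χ i ∧ χ (i + 3) = χ (i + 1) ∧ χ (i + 1) ≠ χ i := by decide
  have hpow : ∀ (i : Fin 5) (k : Fin 5), (M.next ^ (k : ℕ)) ((M.next ^ (i : ℕ)) d) =
      (M.next ^ ((i + k : Fin 5) : ℕ)) d := by
    intro i k
    rw [← Equiv.Perm.mul_apply, ← pow_add, Fin.val_add, add_comm]
    conv_lhs => rw [← Nat.mod_add_div (i + k : ℕ) 5, pow_add, pow_mul, M.next_pow, one_pow, mul_one]
  classical
  have hb : ∀ d', M.vtx d' = M.vtx d → ∀ d'', M.vtx d'' = M.vtx d →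
      (decide (M.vtx (M.rev d') = a) = decide (M.vtx (M.rev d'') = a)) →
      M.vtx (M.rev d') = M.vtx (M.rev d'') := by
    intro d' hd' d'' hd'' h
    rw [decide_eq_decide] at h
    have h1 := hN' d' hd'
    have h2 := hN' d'' hd''
    by_cases h3 : M.vtx (M.rev d') = a
    · rw [h3, h.1 h3]
    · rw [h1.resolve_left h3, h2.resolve_left fun h4 => h3 (h.2 h4)]
  rcases hcyc (fun i => decide (M.vtx (M.rev ((M.next ^ (i : ℕ)) d)) = a)) with
    ⟨i, h1, h2⟩ | ⟨i, h1, h2, h3⟩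
  · set e := (M.next ^ (i : ℕ)) d with he
    have hed : M.vtx e = M.vtx d := M.vtx_pow _ _
    have h1' := hb _ (M.vtx_pow _ _) _ (M.vtx_pow _ _) h1
    have h2' := hb _ (M.vtx_pow _ _) _ (M.vtx_pow _ _) h2
    rw [← hpow i 1] at h1'
    rw [← hpow i 2] at h2'
    rcases hN' e hed with h | h
    · obtain ⟨τ, hτ⟩ := exists_isMirror_of_neighbours hM hJ (e := e) (u := a) (w := b) h
        (h1'.trans h) (h2'.trans h) (fun d' hd' => hN' d' (hd'.trans hed))
      exact ⟨_, _, _, _, _, hτ⟩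
    · obtain ⟨τ, hτ⟩ := exists_isMirror_of_neighbours hM hJ (e := e) (u := b) (w := a) h
        (h1'.trans h) (h2'.trans h) (fun d' hd' => (hN' d' (hd'.trans hed)).symm)
      exact ⟨_, _, _, _, _, hτ⟩
  · have h1' := hb _ (M.vtx_pow _ _) _ (M.vtx_pow _ _) h1
    have h2' := hb _ (M.vtx_pow _ _) _ (M.vtx_pow _ _) h2
    rw [← hpow i 2] at h1'
    rw [← hpow i 3, ← hpow i 1] at h2'
    refine absurd ?_ h3
    rw [decide_eq_decide, ← hpow i 1]
    have := hJ.not_alternate (e := (M.next ^ (i : ℕ)) d) h1' h2' (hM.vtx_rev_ne _)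
      (by rw [← M.vtx_next ((M.next ^ (i : ℕ)) d)]; exact hM.vtx_rev_ne _)
    exact iff_of_eq (congrArg (· = a) this)

namespace IsMirror

variable {u v w : V} {e : D} {τ : D → D}

theorem at_map (h : M.IsMirror u v w e τ) {d : D} (hd : M.At u v d) : M.At u v (τ d) :=
  hd.elim (fun hd => Or.inr (h.vtx_left d hd)) (fun hd => Or.inl (h.vtx_right d hd))

theorem not_at_rev_map (h : M.IsMirror u v w e τ) {d : D} (hd : ¬ M.At u v d)
    (hr : M.At u v (M.rev d)) : ¬ M.At u v (M.rev (τ (M.rev d))) := by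
  intro hc
  have h1 := h.map_eq_rev _ (h.at_map hr) hc
  rw [h.invol _ hr] at h1
  exact hd (by rw [M.rev_injective h1]; exact h.at_map hr)

theorem map_ne (h : M.IsMirror u v w e τ) {d : D} (hd : M.At u v d) : τ d ≠ d := by
  intro hc
  rcases hd with hd | hd
  · exact h.ne (hd.symm.trans ((congrArg M.vtx hc).symm.trans (h.vtx_left d hd)))
  · exact h.ne ((h.vtx_right d hd).symm.trans ((congrArg M.vtx hc).trans hd))

open Classical in
/-- The reduction: `u` and `v` are deleted, and each edge that entered one of them is continued by
the edge that leaves the other one at the mirror image. -/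
noncomputable def reduce (h : M.IsMirror u v w e τ) :
    FiveMap {d : D // ¬ M.At u v d} {x : V // ¬ (x = u ∨ x = v)} where
  next := M.next.subtypePerm fun _ => not_congr at_next
  rev d := if hd : M.At u v (M.rev d.1) then ⟨M.rev (τ (M.rev d.1)), h.not_at_rev_map d.2 hd⟩
    else ⟨M.rev d.1, hd⟩
  vtx d := ⟨M.vtx d.1, d.2⟩
  rev_rev d := by
    by_cases hd : M.At u v (M.rev d.1)
    · have h2 : M.At u v (M.rev (M.rev (τ (M.rev d.1)))) := by
        rw [M.rev_rev]; exact h.at_map hd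
      simp only [dif_pos hd, dif_pos h2]
      simp only [M.rev_rev, h.invol _ hd]
    · have h2 : ¬ M.At u v (M.rev (M.rev d.1)) := by
        rw [M.rev_rev]; exact d.2
      simp only [dif_neg hd, dif_neg h2]
      simp only [M.rev_rev]
  rev_ne d := by
    by_cases hd : M.At u v (M.rev d.1)
    · simp only [dif_pos hd]
      intro hc
      have h1 : M.rev (τ (M.rev d.1)) = d.1 := congrArg Subtype.val hc
      have h2 := congrArg M.rev h1
      rw [M.rev_rev] at h2
      exact h.map_ne hd h2
    · simp only [dif_neg hd]
      exact fun hc => M.rev_ne d.1 (congrArg Subtype.val hc)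
  vtx_next d := Subtype.ext (M.vtx_next d.1)
  next_ne d := fun hc => M.next_ne d.1 (congrArg Subtype.val hc)
  next_pow := by
    rw [Equiv.Perm.subtypePerm_pow]
    ext d
    simp [M.next_pow]
  exists_pow d d' hd := by
    obtain ⟨k, hk, hkd⟩ := M.exists_pow d.1 d'.1 (congrArg Subtype.val hd)
    refine ⟨k, hk, Subtype.ext ?_⟩
    rw [Equiv.Perm.subtypePerm_pow]
    exact hkd

theorem reduce_next_pow (h : M.IsMirror u v w e τ) (k : ℕ) (d : {d : D // ¬ M.At u v d}) :
    ((h.reduce.next ^ k) d).1 = (M.next ^ k) d.1 := by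
  rw [reduce, Equiv.Perm.subtypePerm_pow]
  rfl

theorem reduce_rev_of_at (h : M.IsMirror u v w e τ) {d : {d : D // ¬ M.At u v d}}
    (hd : M.At u v (M.rev d.1)) : (h.reduce.rev d).1 = M.rev (τ (M.rev d.1)) := by
  simp only [reduce, dif_pos hd]

theorem reduce_rev_of_not_at (h : M.IsMirror u v w e τ) {d : {d : D // ¬ M.At u v d}}
    (hd : ¬ M.At u v (M.rev d.1)) : (h.reduce.rev d).1 = M.rev d.1 := by
  simp only [reduce, dif_neg hd]

/-- One of the two ends of a new edge is `w`. -/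
theorem vtx_eq_or (h : M.IsMirror u v w e τ) {d : {d : D // ¬ M.At u v d}}
    (hd : M.At u v (M.rev d.1)) :
    M.vtx (M.rev d.1) = v ∧ M.vtx d.1 = w ∨
      M.vtx (M.rev d.1) = u ∧ M.vtx (h.reduce.rev d).1 = w := by
  rcases hd with hd' | hd'
  · refine Or.inr ⟨hd', ?_⟩
    rw [h.reduce_rev_of_at (Or.inl hd')]
    exact h.vtx_rev_of_not _ (h.vtx_left _ hd') (h.not_at_rev_map d.2 (Or.inl hd'))
  · refine Or.inl ⟨hd', ?_⟩
    have := h.vtx_rev_of_not _ hd' (by rw [M.rev_rev]; exact d.2)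
    rwa [M.rev_rev] at this

/-- A cut of the reduced map whose set avoids `w` is a cut of the original map, and one of a set and
its complement avoids `w`. -/
theorem oddCut_reduce (h : M.IsMirror u v w e τ) (hM : M.OddCut) : h.reduce.OddCut := by
  have key : ∀ X : Set {x : V // ¬ (x = u ∨ x = v)}, (∀ x ∈ X, x.1 ≠ w) →
      (h.reduce.cut X).ncard = (M.cut (Subtype.val '' X)).ncard := by
    intro X hX
    rw [← Set.ncard_image_of_injective (h.reduce.cut X) Subtype.val_injective]
    congr 1
    have hmem : ∀ d : {d : D // ¬ M.At u v d},
        h.reduce.vtx d ∈ X ↔ M.vtx d.1 ∈ Subtype.val '' X := by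
      intro d
      constructor
      · exact fun hd => ⟨_, hd, rfl⟩
      · rintro ⟨x, hx, hxd⟩
        have : h.reduce.vtx d = x := Subtype.ext hxd.symm
        rwa [this]
    have hrev : ∀ d : {d : D // ¬ M.At u v d}, h.reduce.vtx d ∈ X →
        (h.reduce.vtx (h.reduce.rev d) ∈ X ↔ M.vtx (M.rev d.1) ∈ Subtype.val '' X) := by
      intro d hdX
      by_cases hd : M.At u v (M.rev d.1)
      · rcases h.vtx_eq_or hd with ⟨-, h2⟩ | ⟨h1, h2⟩
        · exact absurd h2 (hX _ hdX)
        · refine iff_of_false (fun hc => hX _ hc h2) ?_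
          rintro ⟨x, -, hx⟩
          exact x.2 (Or.inl (hx.trans h1))
      · rw [hmem, h.reduce_rev_of_not_at hd]
    ext d
    constructor
    · rintro ⟨d, ⟨h1, h2⟩, rfl⟩
      exact ⟨(hmem d).1 h1, fun hc => h2 ((hrev d h1).2 hc)⟩
    · rintro ⟨h1, h2⟩
      have hd : ¬ M.At u v d := by
        obtain ⟨x, -, hx⟩ := h1
        exact fun hc => x.2 (by rw [hx]; exact hc)
      have h3 := (hmem ⟨d, hd⟩).2 h1
      exact ⟨⟨d, hd⟩, ⟨h3, fun hc => h2 ((hrev ⟨d, hd⟩ h3).1 hc)⟩, rfl⟩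
  intro X
  by_cases hX : ∀ x ∈ X, x.1 ≠ w
  · rw [key X hX]
    exact hM _
  · rw [← ncard_cut_compl, key Xᶜ]
    · exact hM _
    · push Not at hX
      obtain ⟨x, hx, rfl⟩ := hX
      intro y hy hyx
      exact hy (by rwa [Subtype.ext hyx])

/-- The reduced graph is a minor of the original graph: `u` and `v` are contracted into `w`. -/
theorem hasMinor_of_reduce (h : M.IsMirror u v w e τ) {W : Type*} {K : SimpleGraph W}
    (hK : h.reduce.graph.HasMinor K) : M.graph.HasMinor K := by
  have hvu : M.graph.Adj v u := ⟨h.ne.symm, e, h.vtx_base, h.vtx_rev_base⟩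
  refine SimpleGraph.HasMinor.of_model (fun x : {x : V // ¬ (x = u ∨ x = v)} =>
    {y | y = x.1 ∨ (M.graph.Adj v w ∧ x.1 = w) ∧ (y = u ∨ y = v)}) ?_ ?_ ?_ hK
  · intro x
    by_cases hx : M.graph.Adj v w ∧ x.1 = w
    · have : {y | y = x.1 ∨ (M.graph.Adj v w ∧ x.1 = w) ∧ (y = u ∨ y = v)} =
          ({w} : Set V) ∪ {v, u} := by
        ext y
        simp only [hx.1, hx.2, Set.mem_ofPred_eq, Set.mem_union, Set.mem_singleton_iff,
          Set.mem_insert_iff]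
        tauto
      rw [this]
      exact SimpleGraph.connected_induce_union (by simp)
        (SimpleGraph.induce_pair_connected_of_adj hvu).preconnected (Set.mem_singleton w)
        (Set.mem_insert v _) hx.1.symm
    · have : {y | y = x.1 ∨ (M.graph.Adj v w ∧ x.1 = w) ∧ (y = u ∨ y = v)} =
          ({x.1} : Set V) := by
        ext y
        simp [hx]
      rw [this]
      exact SimpleGraph.Connected.mk (by simp)
  · intro x y hxy
    rw [Set.disjoint_left]
    rintro z (rfl | ⟨⟨-, h1⟩, h2⟩) (h3 | ⟨⟨-, h3⟩, h4⟩)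
    · exact hxy (Subtype.ext h3)
    · exact x.2 h4
    · exact y.2 (h3 ▸ h2)
    · exact hxy (Subtype.ext (h1.trans h3.symm))
  · rintro x y ⟨hne, d, hdx, hdy⟩
    have hdx' : M.vtx d.1 = x.1 := congrArg Subtype.val hdx
    have hdy' : M.vtx (h.reduce.rev d).1 = y.1 := congrArg Subtype.val hdy
    by_cases hd : M.At u v (M.rev d.1)
    · have hrr := h.reduce_rev_of_at hd
      have hnd := h.not_at_rev_map d.2 hd
      rcases h.vtx_eq_or hd with ⟨h1, h2⟩ | ⟨h1, h2⟩
      · have hvw : M.graph.Adj v w :=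
          ⟨fun h => d.2 (Or.inr (h2.trans h.symm)), M.rev d.1, h1, by rw [M.rev_rev, h2]⟩
        refine ⟨u, Or.inr ⟨⟨hvw, hdx'.symm.trans h2⟩, Or.inl rfl⟩, y.1, Or.inl rfl,
          fun hc => y.2 (Or.inl hc.symm), τ (M.rev d.1), h.vtx_right _ h1, ?_⟩
        rw [← hrr, hdy']
      · have hvw : M.graph.Adj v w :=
          ⟨fun h => y.2 (Or.inr (by rw [← hdy', h2, h])), τ (M.rev d.1), h.vtx_left _ h1,
            by rw [← hrr, h2]⟩
        exact ⟨x.1, Or.inl rfl, u, Or.inr ⟨⟨hvw, hdy'.symm.trans h2⟩, Or.inl rfl⟩,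
          fun hc => x.2 (Or.inl hc), d.1, hdx', h1⟩
    · rw [h.reduce_rev_of_not_at hd] at hdy'
      exact ⟨x.1, Or.inl rfl, y.1, Or.inl rfl, fun hc => hne (Subtype.ext hc), d.1, hdx', hdy'⟩

end IsMirror

end FiveMap

/-! ### Lifting face colourings and edge colourings through the reduction -/

/-- A sequence of colours around a vertex, up to rotation and reflection: `0, 1, 2, 3, 4` or
`0, 3, 4, 1, 2`. The cube function gives the second order, as `3 * k ^ 3` runs through
`0, 3, 4, 1, 2` in `ZMod 5`. -/
def IsPattern (q : ZMod 5 → ZMod 5) : Prop :=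
  ∃ s i : ZMod 5, (s = 1 ∨ s = -1) ∧ ((∀ k, q k = s * k + i) ∨ ∀ k, q k = 3 * (s * k + i) ^ 3)

theorem IsPattern.shift {q : ZMod 5 → ZMod 5} (h : IsPattern q) (j : ZMod 5) :
    IsPattern fun k => q (k + j) := by
  obtain ⟨s, i, hs, h | h⟩ := h
  · exact ⟨s, s * j + i, hs, Or.inl fun k => by beta_reduce; rw [h]; ring⟩
  · exact ⟨s, s * j + i, hs, Or.inr fun k => by beta_reduce; rw [h]; ring⟩

theorem IsPattern.reflect {q : ZMod 5 → ZMod 5} (h : IsPattern q) (j : ZMod 5) :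
    IsPattern fun k => q (j - k) := by
  obtain ⟨s, i, hs, h⟩ := h
  refine ⟨-s, s * j + i, hs.symm.imp (fun h => by rw [h, neg_neg]) (fun h => by rw [h]), ?_⟩
  rcases h with h | h
  · exact Or.inl fun k => by beta_reduce; rw [h]; ring
  · exact Or.inr fun k => by beta_reduce; rw [h]; ring

theorem exists_isPattern (j c : ZMod 5) : ∃ q, IsPattern q ∧ q j = c :=
  ⟨fun k => k + (c - j), ⟨1, c - j, Or.inl rfl, Or.inl fun k => by ring⟩, by ring⟩

namespace FiveMap

variable {D V : Type*} {M : FiveMap D V}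

theorem sum_next {A : Type*} [AddCommMonoid A] (f : D → A) (d : D) :
    ∑ k ∈ Finset.range 5, f ((M.next ^ k) (M.next d)) =
      ∑ k ∈ Finset.range 5, f ((M.next ^ k) d) := by
  rw [Finset.sum_range_succ, Finset.sum_range_succ' (fun k => f ((M.next ^ k) d))]
  have h5 : (M.next ^ 4) (M.next d) = (M.next ^ 0) d := by
    change (M.next ^ 5) d = _
    rw [M.next_pow, pow_zero]
  rw [h5]
  rfl

theorem sum_vtx_eq {A : Type*} [AddCommMonoid A] (f : D → A) {d d' : D} (h : M.vtx d' = M.vtx d) :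
    ∑ k ∈ Finset.range 5, f ((M.next ^ k) d') = ∑ k ∈ Finset.range 5, f ((M.next ^ k) d) := by
  obtain ⟨k, -, rfl⟩ := M.exists_pow d d' h.symm
  clear h
  induction k with
  | zero => rfl
  | succ k ih => rw [← ih, ← sum_next f ((M.next ^ k) d), pow_succ', Equiv.Perm.mul_apply]

theorem apply_of_step {P : D → Prop} (h : ∀ d, P d → P (M.next d)) {d d' : D} (hd : P d)
    (hv : M.vtx d' = M.vtx d) : P d' := by
  obtain ⟨k, -, rfl⟩ := M.exists_pow d d' hv.symm
  clear hv
  induction k with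
  | zero => exact hd
  | succ k ih => rw [pow_succ', Equiv.Perm.mul_apply]; exact h _ ih

namespace IsMirror

variable {u v w : V} {e : D} {τ : D → D}

theorem at_base (h : M.IsMirror u v w e τ) : M.At u v e := Or.inr h.vtx_base

theorem at_rev_base (h : M.IsMirror u v w e τ) : M.At u v (M.rev e) := Or.inl h.vtx_rev_base

theorem at_zpow (M : FiveMap D V) {u v : V} (k : ℤ) {d : D} :
    M.At u v ((M.next ^ k) d) ↔ M.At u v d := by
  rw [At, At, M.vtx_zpow]

theorem at_pow (M : FiveMap D V) {u v : V} (k : ℕ) {d : D} :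
    M.At u v ((M.next ^ k) d) ↔ M.At u v d := by
  rw [At, At, M.vtx_pow]

theorem map_pow (h : M.IsMirror u v w e τ) {d : D} (hd : M.At u v d) (k : ℕ) :
    (M.next ^ k) (τ ((M.next ^ k) d)) = τ d := by
  induction k with
  | zero => rfl
  | succ k ih =>
    have h1 : (M.next ^ (k + 1)) d = M.next ((M.next ^ k) d) := by
      rw [pow_succ', Equiv.Perm.mul_apply]
    rw [h1, pow_succ, Equiv.Perm.mul_apply, h.map_next _ ((at_pow M k).2 hd), ih]

/-- A function invariant under the reflection has the same sum at `u` and at `v`. -/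
theorem sum_map (h : M.IsMirror u v w e τ) {A : Type*} [AddCommMonoid A] (f : D → A)
    (hf : ∀ d, M.At u v d → f (τ d) = f d) {d : D} (hd : M.At u v d) :
    ∑ k ∈ Finset.range 5, f ((M.next ^ k) (τ d)) = ∑ k ∈ Finset.range 5, f ((M.next ^ k) d) := by
  have hz : M.vtx (τ d) = M.vtx (τ ((M.next ^ 4) d)) := by
    rw [← h.map_pow hd 4, M.vtx_pow]
  rw [sum_vtx_eq f hz, ← Finset.sum_range_reflect]
  refine Finset.sum_congr rfl fun k hk => ?_
  have hk4 : k ≤ 4 := by simpa [Nat.lt_succ_iff] using hk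
  have h4 : (M.next ^ 4) d = (M.next ^ (4 - k)) ((M.next ^ k) d) := by
    rw [← Equiv.Perm.mul_apply, ← pow_add, Nat.sub_add_cancel hk4]
  rw [show 5 - 1 - k = 4 - k from rfl, h4, h.map_pow ((at_pow M k).2 hd),
    hf _ ((at_pow M k).2 hd)]

/-- An even edge set of the reduced map lifts to one of the original map: the new edges become
paths through `u` and `v`, completed by one edge between `u` and `v` if necessary. The colouring of
the faces can then be restricted, because the faces at mirror images on `u` and `v` have equal
colours. -/
theorem jordan_reduce (h : M.IsMirror u v w e τ) (hJ : M.Jordan) : h.reduce.Jordan := by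
  classical
  intro C' hrev' hsum'
  set C₁ : D → ZMod 2 := fun d => if hd : M.At u v d then
    (if hr : M.At u v (M.rev d) then 0 else C' ⟨M.rev d, hr⟩) else C' ⟨d, hd⟩ with hC₁
  have hC₁_not : ∀ d (hd : ¬ M.At u v d), C₁ d = C' ⟨d, hd⟩ := fun d hd => by
    rw [hC₁]; exact dif_neg hd
  have hC₁_at : ∀ d, M.At u v d → ∀ hr : ¬ M.At u v (M.rev d), C₁ d = C' ⟨M.rev d, hr⟩ :=
    fun d hd hr => by
      simp only [hC₁, dif_pos hd, dif_neg hr]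
  have hC₁_zero : ∀ d, M.At u v d → M.At u v (M.rev d) → C₁ d = 0 := fun d hd hr => by
      simp only [hC₁, dif_pos hd, dif_pos hr]
  have hC₁_rev : ∀ d, C₁ (M.rev d) = C₁ d := by
    intro d
    by_cases hd : M.At u v d <;> by_cases hr : M.At u v (M.rev d)
    · rw [hC₁_zero _ hd hr, hC₁_zero _ hr (by rwa [M.rev_rev])]
    · rw [hC₁_at _ hd hr, hC₁_not _ hr]
    · rw [hC₁_not _ hd, hC₁_at _ hr (by rwa [M.rev_rev])]
      congr 1
      exact Subtype.ext (M.rev_rev d)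
    · rw [hC₁_not _ hd, hC₁_not _ hr, ← hrev' ⟨d, hd⟩]
      congr 1
      exact Subtype.ext (h.reduce_rev_of_not_at (d := ⟨d, hd⟩) hr).symm
  have hC₁_map : ∀ d, M.At u v d → C₁ (τ d) = C₁ d := by
    intro d hd
    by_cases hr : M.At u v (M.rev d)
    · rw [h.map_eq_rev d hd hr, hC₁_rev]
    · have hr' := h.not_at_rev_map hr (by rwa [M.rev_rev])
      have hred := h.reduce_rev_of_at (d := ⟨M.rev d, hr⟩) (by rwa [M.rev_rev])
      simp only [M.rev_rev] at hr' hred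
      rw [hC₁_at _ (h.at_map hd) hr', hC₁_at _ hd hr, ← hrev' ⟨M.rev d, hr⟩]
      congr 1
      exact Subtype.ext hred.symm
  have hre : ∀ a b, M.rev a = b ↔ a = M.rev b := fun a b =>
    ⟨fun h => by rw [← h, M.rev_rev], fun h => by rw [h, M.rev_rev]⟩
  set t := ∑ k ∈ Finset.range 5, C₁ ((M.next ^ k) e) with ht
  set C : D → ZMod 2 := fun d =>
    C₁ d + t * ((if d = e then 1 else 0) + (if d = M.rev e then 1 else 0)) with hC
  have hC_rev : ∀ d, C (M.rev d) = C d := by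
    intro d
    simp only [hC, hC₁_rev, hre, M.rev_rev]
    ring
  have hC_map : ∀ d, M.At u v d → C (τ d) = C d := by
    intro d hd
    have h1 : τ d = e ↔ d = M.rev e := by
      rw [← h.map_base]
      exact ⟨fun h' => by rw [← h', h.invol _ hd], fun h' => by rw [h', h.invol _ h.at_base]⟩
    have h2 : τ d = M.rev e ↔ d = e := by
      rw [← h.map_base]
      exact ⟨fun h' => by rw [← h.invol _ hd, h', h.invol _ h.at_base], fun h' => by rw [h']⟩
    simp only [hC, hC₁_map d hd, h1, h2]
    ring
  have hC_not : ∀ d (hd : ¬ M.At u v d), C d = C' ⟨d, hd⟩ := by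
    intro d hd
    have h1 : d ≠ e := by rintro rfl; exact hd h.at_base
    have h2 : d ≠ M.rev e := by rintro rfl; exact hd h.at_rev_base
    simp only [hC, h1, h2, if_false, hC₁_not d hd, add_zero, mul_zero]
  have hne : M.vtx e ≠ M.vtx (M.rev e) := by
    rw [h.vtx_base, h.vtx_rev_base]; exact h.ne.symm
  have hsum_e : ∑ k ∈ Finset.range 5, C ((M.next ^ k) e) = 0 := by
    simp only [hC, Finset.sum_add_distrib, ← Finset.mul_sum, sum_indicator, if_neg hne, ← ht]
    simp [CharTwo.add_self_eq_zero]
  have hsum : ∀ d, ∑ k ∈ Finset.range 5, C ((M.next ^ k) d) = 0 := by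
    intro d
    by_cases hd : M.At u v d
    · rcases hd with hd' | hd'
      · rw [sum_vtx_eq C (hd'.trans h.vtx_rev_base.symm), ← h.map_base,
          h.sum_map C hC_map h.at_base, hsum_e]
      · rw [sum_vtx_eq C (hd'.trans h.vtx_base.symm), hsum_e]
    · rw [← hsum' ⟨d, hd⟩]
      refine Finset.sum_congr rfl fun k _ => ?_
      have hk : ¬ M.At u v ((M.next ^ k) d) := by rwa [at_pow]
      rw [hC_not _ hk]
      congr 1
      exact Subtype.ext (h.reduce_next_pow k ⟨d, hd⟩).symm
  obtain ⟨s, hs⟩ := hJ C hC_rev hsum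
  have hstep : ∀ d, s (M.next d) = s d + C d := fun d => by
    rw [(hs d).1, ← (hs d).2, ← add_assoc, CharTwo.add_self_eq_zero, zero_add]
  -- faces at mirror images have the same colour
  have hmirror : ∀ d, M.At u v d → s (M.next (τ d)) = s d := by
    have hP : ∀ d, (M.At u v d ∧ s (M.next (τ d)) = s d) →
        (M.At u v (M.next d) ∧ s (M.next (τ (M.next d))) = s (M.next d)) := by
      rintro d ⟨hd, hsd⟩
      refine ⟨at_next.2 hd, ?_⟩
      rw [h.map_next d hd, hstep d, ← hsd, hstep (τ d), hC_map d hd, add_assoc,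
        CharTwo.add_self_eq_zero, add_zero]
    rintro d (hd | hd)
    · refine (apply_of_step hP ⟨h.at_rev_base, ?_⟩ (hd.trans h.vtx_rev_base.symm)).2
      rw [← h.map_base, h.invol _ h.at_base, (hs e).1, h.map_base]
    · refine (apply_of_step hP ⟨h.at_base, ?_⟩ (hd.trans h.vtx_base.symm)).2
      rw [h.map_base, (hs _).1, M.rev_rev]
  have hrev : ∀ d, s (h.reduce.rev d).1 = s (M.rev d.1) := by
    intro d
    by_cases hd : M.At u v (M.rev d.1)
    · rw [h.reduce_rev_of_at hd, ← (hs _).1, hmirror _ hd]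
    · rw [h.reduce_rev_of_not_at hd]
  refine ⟨fun d => s d.1, fun d => ⟨?_, ?_⟩⟩
  · beta_reduce
    rw [hrev, ← (hs d.1).1]
    rfl
  · beta_reduce
    rw [hrev, (hs d.1).2, hC_not]

end IsMirror

/-- A colouring of the edges with the colours `0, …, 4` whose cyclic order at every vertex is one
of the two patterns. -/
def IsPatternColouring (M : FiveMap D V) (f : D → ZMod 5) : Prop :=
  (∀ d, f (M.rev d) = f d) ∧
    ∀ d, ∃ q, IsPattern q ∧ ∀ k : ℤ, f ((M.next ^ k) d) = q k

theorem exists_apply_zpow (e : D) (p : ZMod 5 → ZMod 5) :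
    ∃ col : D → ZMod 5, ∀ k : ℤ, col ((M.next ^ k) e) = p k := by
  classical
  refine ⟨fun d => if h : ∃ k : ℤ, (M.next ^ k) e = d then p h.choose else 0, fun k => ?_⟩
  have hk : ∃ l : ℤ, (M.next ^ l) e = (M.next ^ k) e := ⟨k, rfl⟩
  beta_reduce
  rw [dif_pos hk]
  have := hk.choose_spec
  rw [M.zpow_eq_zpow_iff] at this
  congr 1
  exact (ZMod.intCast_eq_intCast_iff _ _ 5).2 this

namespace IsMirror

variable {u v w : V} {e : D} {τ : D → D}

/-- A pattern at `v` that agrees with the given colouring of the reduced map. If two edges at `v`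
are prescribed, their colours are consecutive around `w`, hence also in a reflected pattern. -/
theorem exists_pattern (h : M.IsMirror u v w e τ) {f : {d : D // ¬ M.At u v d} → ZMod 5}
    (hf : h.reduce.IsPatternColouring f) :
    ∃ p, IsPattern p ∧ ∀ (k : ℤ) (hr : ¬ M.At u v (M.rev ((M.next ^ k) e))),
      p k = f ⟨M.rev ((M.next ^ k) e), hr⟩ := by
  obtain ⟨p, hp, h3, h4⟩ : ∃ p, IsPattern p ∧
      (∀ hr : ¬ M.At u v (M.rev ((M.next ^ 3) e)), p 3 = f ⟨M.rev ((M.next ^ 3) e), hr⟩) ∧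
      ∀ hr : ¬ M.At u v (M.rev ((M.next ^ 4) e)), p 4 = f ⟨M.rev ((M.next ^ 4) e), hr⟩ := by
    by_cases h3 : M.At u v (M.rev ((M.next ^ 3) e))
    · by_cases h4 : M.At u v (M.rev ((M.next ^ 4) e))
      · obtain ⟨p, hp, -⟩ := exists_isPattern 0 0
        exact ⟨p, hp, fun hr => absurd h3 hr, fun hr => absurd h4 hr⟩
      · obtain ⟨p, hp, hpc⟩ := exists_isPattern 4 (f ⟨_, h4⟩)
        exact ⟨p, hp, fun hr => absurd h3 hr, fun _ => hpc⟩
    · by_cases h4 : M.At u v (M.rev ((M.next ^ 4) e))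
      · obtain ⟨p, hp, hpc⟩ := exists_isPattern 3 (f ⟨_, h3⟩)
        exact ⟨p, hp, fun _ => hpc, fun hr => absurd h4 hr⟩
      · obtain ⟨q, hq, hqf⟩ := hf.2 ⟨_, h4⟩
        refine ⟨fun k => q (4 - k), hq.reflect 4, fun _ => ?_, fun _ => ?_⟩
        · have h1 := hqf 1
          beta_reduce
          rw [show (4 : ZMod 5) - 3 = ((1 : ℤ) : ZMod 5) by decide, ← h1]
          congr 1
          exact Subtype.ext (h.next_rev_four h3 h4)
        · have h0 := hqf 0
          beta_reduce
          rw [show (4 : ZMod 5) - 4 = ((0 : ℤ) : ZMod 5) by decide, ← h0]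
          rfl
  have key : ∀ m : ℕ, m < 5 → ∀ hr : ¬ M.At u v (M.rev ((M.next ^ m) e)),
      p m = f ⟨M.rev ((M.next ^ m) e), hr⟩ := by
    intro m hm hr
    interval_cases m
    · exact absurd (Or.inl h.vtx_rev_base) hr
    · exact absurd (Or.inl h.vtx_rev_one) hr
    · exact absurd (Or.inl h.vtx_rev_two) hr
    · exact h3 hr
    · exact h4 hr
  refine ⟨p, hp, fun k hr => ?_⟩
  have hk := M.zpow_eq_pow k
  have hkp : (k : ZMod 5) = (((k % 5).toNat : ℕ) : ZMod 5) := by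
    rw [← Int.cast_natCast, Int.toNat_of_nonneg (Int.emod_nonneg _ (by norm_num))]
    exact (ZMod.intCast_eq_intCast_iff _ _ 5).2 (Int.mod_modEq k 5).symm
  have hlt : (k % 5).toNat < 5 := by omega
  rw [hkp]
  simp only [hk] at hr ⊢
  exact key _ hlt hr

theorem exists_isPatternColouring (h : M.IsMirror u v w e τ)
    {f : {d : D // ¬ M.At u v d} → ZMod 5} (hf : h.reduce.IsPatternColouring f) :
    ∃ g, M.IsPatternColouring g := by
  classical
  obtain ⟨p, hp, hpf⟩ := h.exists_pattern hf
  obtain ⟨col, hcol⟩ := exists_apply_zpow (M := M) e p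
  have hcol' : ∀ d, M.vtx d = v → ∀ hr : ¬ M.At u v (M.rev d), col d = f ⟨M.rev d, hr⟩ := by
    intro d hd hr
    obtain ⟨k, rfl⟩ := exists_zpow (hd.trans h.vtx_base.symm)
    rw [hcol, hpf]
  set g : D → ZMod 5 := fun d => if hd : M.At u v d then
    (if M.vtx d = v then col d else col (τ d)) else f ⟨d, hd⟩ with hg
  have hg_not : ∀ d (hd : ¬ M.At u v d), g d = f ⟨d, hd⟩ := fun d hd => dif_neg hd
  have hg_v : ∀ d, M.vtx d = v → g d = col d := fun d hd => by
    simp only [hg, dif_pos (show M.At u v d from Or.inr hd), if_pos hd]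
  have hg_u : ∀ d, M.vtx d = u → g d = col (τ d) := fun d hd => by
    have : M.vtx d ≠ v := fun h' => h.ne (hd.symm.trans h')
    simp only [hg, dif_pos (show M.At u v d from Or.inl hd), if_neg this]
  have hg_map : ∀ d, M.At u v d → g (τ d) = g d := by
    rintro d (hd | hd)
    · rw [hg_v _ (h.vtx_left d hd), hg_u d hd]
    · rw [hg_u _ (h.vtx_right d hd), hg_v d hd, h.invol _ (Or.inr hd)]
  -- an edge leaving the pair `u`, `v` has the colour of the new edge that contains it
  have hout : ∀ d, M.At u v d → ∀ hr : ¬ M.At u v (M.rev d), g d = f ⟨M.rev d, hr⟩ := by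
    rintro d (hd | hd) hr
    · have hr' := h.not_at_rev_map hr (by rw [M.rev_rev]; exact Or.inl hd)
      have hred := h.reduce_rev_of_at (d := ⟨M.rev d, hr⟩) (by rw [M.rev_rev]; exact Or.inl hd)
      simp only [M.rev_rev] at hr' hred
      rw [hg_u d hd, hcol' _ (h.vtx_left d hd) hr', ← hf.1 ⟨M.rev d, hr⟩]
      congr 1
      exact Subtype.ext hred.symm
    · rw [hg_v d hd, hcol' d hd hr]
  refine ⟨g, fun d => ?_, fun d => ?_⟩
  · by_cases hd : M.At u v d <;> by_cases hr : M.At u v (M.rev d)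
    · rw [← h.map_eq_rev d hd hr, hg_map d hd]
    · rw [hout d hd hr, hg_not _ hr]
    · rw [hout _ hr (by rwa [M.rev_rev]), hg_not _ hd]
      congr 1
      exact Subtype.ext (M.rev_rev d)
    · rw [hg_not _ hd, hg_not _ hr, ← hf.1 ⟨d, hd⟩]
      congr 1
      exact Subtype.ext (h.reduce_rev_of_not_at (d := ⟨d, hd⟩) hr).symm
  · by_cases hd : M.At u v d
    · have hv : ∀ d, M.vtx d = v → ∃ i : ℤ, ∀ k : ℤ, g ((M.next ^ k) d) = p (k + i) := by
        intro d hd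
        obtain ⟨i, rfl⟩ := exists_zpow (hd.trans h.vtx_base.symm)
        refine ⟨i, fun k => ?_⟩
        rw [hg_v _ (by rw [M.vtx_zpow, hd]), ← Equiv.Perm.mul_apply, ← zpow_add, hcol]
        push_cast
        rfl
      rcases hd with hd | hd
      · obtain ⟨i, hi⟩ := hv _ (h.vtx_left d hd)
        refine ⟨_, hp.reflect i, fun k => ?_⟩
        have hz : τ ((M.next ^ k) d) = (M.next ^ (-k)) (τ d) := by
          have hn := h.map_pow (d := d) (Or.inl hd) (k % 5).toNat
          rw [← M.zpow_eq_pow] at hn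
          rw [← hn, ← Equiv.Perm.mul_apply, ← zpow_add, neg_add_cancel]
          rfl
        rw [← hg_map _ (Or.inl (by rw [M.vtx_zpow, hd])), hz, hi]
        congr 1
        push_cast
        ring
      · obtain ⟨i, hi⟩ := hv d hd
        exact ⟨_, hp.shift i, hi⟩
    · obtain ⟨q, hq, hqf⟩ := hf.2 ⟨d, hd⟩
      refine ⟨q, hq, fun k => ?_⟩
      rw [← hqf, hg_not _ (by rwa [at_zpow])]
      congr 1
      apply Subtype.ext
      rw [h.reduce.zpow_eq_pow, h.reduce_next_pow, ← M.zpow_eq_pow]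

end IsMirror

/-- Every plane `K₄`-minor-free `5`-graph has a colouring with the two cyclic orders. -/
theorem exists_isPatternColouring {D V : Type*} [Finite D] [Finite V] (M : FiveMap D V)
    (hM : M.OddCut) (hJ : M.Jordan) (hK : ¬ M.graph.HasMinor (⊤ : SimpleGraph (Fin 4))) :
    ∃ f, M.IsPatternColouring f := by
  obtain ⟨n, hn⟩ : ∃ n, n = Nat.card D := ⟨_, rfl⟩
  induction n using Nat.strong_induction_on generalizing D V with
  | _ n ih =>
  rcases isEmpty_or_nonempty D with hD | hD
  · exact ⟨fun _ => 0, fun d => hD.elim d, fun d => hD.elim d⟩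
  obtain ⟨u, v, w, e, τ, h⟩ := exists_isMirror hM hJ hK
  have hlt : Nat.card {d : D // ¬ M.At u v d} < n := by
    rw [hn]
    exact Finite.card_subtype_lt (x := e) (not_not.2 h.at_base)
  obtain ⟨f, hf⟩ := ih _ hlt h.reduce (h.oddCut_reduce hM) (h.jordan_reduce hJ)
    (fun hc => hK (h.hasMinor_of_reduce hc)) rfl
  exact h.exists_isPatternColouring hf

end FiveMap

/-! ### From Euler's formula to the Jordan curve theorem -/

namespace FiveMap

variable {D V : Type*} (M : FiveMap D V)

/-- The permutation that traces the facial walks. -/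
def facePerm : Equiv.Perm D := (Function.Involutive.toPerm M.rev M.rev_rev).trans M.next

/-- The faces of a combinatorial map. -/
abbrev Face : Type _ := Quotient (Equiv.Perm.SameCycle.setoid M.facePerm)

/-- The face between `next⁻¹ d` and `d`. -/
def face (d : D) : M.Face := Quotient.mk _ d

theorem face_next (d : D) : M.face (M.next d) = M.face (M.rev d) := by
  have h : M.facePerm (M.rev d) = M.next d := congrArg M.next (M.rev_rev d)
  rw [← h]
  exact Quotient.sound (Equiv.Perm.SameCycle.refl _ _).apply_left

/-- Euler's formula yields the Jordan curve theorem by counting dimensions over `ZMod 2`: the edge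
sets that separate a union of faces from the other faces are even, they form a space of dimension
at least `|F| - c`, and the even edge sets form a space of dimension at most `|E| - |V| + c`. -/
theorem jordan_of_euler [Finite D] [Finite V] {E : Type*} [Finite E] (edge : D → E)
    (hedge : ∀ d d', edge d = edge d' ↔ d = d' ∨ d = M.rev d')
    (hsurj : Function.Surjective edge) (hvtx : Function.Surjective M.vtx)
    (heuler : 2 * Nat.card M.graph.ConnectedComponent + Nat.card E ≤
      Nat.card V + Nat.card M.Face) : M.Jordan := by
  classical
  have := Fintype.ofFinite V
  have := Fintype.ofFinite E
  have := Fintype.ofFinite M.Face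
  have := Fintype.ofFinite M.graph.ConnectedComponent
  simp only [Nat.card_eq_fintype_card] at heuler
  let dart : E → D := Function.surjInv hsurj
  have hdart : ∀ x, edge (dart x) = x := Function.surjInv_eq hsurj
  let at' : V → D := Function.surjInv hvtx
  have hat : ∀ x, M.vtx (at' x) = x := Function.surjInv_eq hvtx
  let δ : (M.Face → ZMod 2) →ₗ[ZMod 2] (E → ZMod 2) :=
    { toFun := fun s x => s (M.face (dart x)) + s (M.face (M.rev (dart x)))
      map_add' := fun s t => by ext x; simp only [Pi.add_apply]; ring
      map_smul' := fun a s => by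
        ext x; simp only [Pi.smul_apply, smul_eq_mul, RingHom.id_apply]; ring }
  let β : (E → ZMod 2) →ₗ[ZMod 2] (V → ZMod 2) :=
    { toFun := fun C x => ∑ k ∈ Finset.range 5, C (edge ((M.next ^ k) (at' x)))
      map_add' := fun s t => by ext x; simp only [Pi.add_apply, Finset.sum_add_distrib]
      map_smul' := fun a s => by
        ext x; simp only [Pi.smul_apply, smul_eq_mul, RingHom.id_apply, Finset.mul_sum] }
  have hδ : ∀ s d, δ s (edge d) = s (M.face d) + s (M.face (M.rev d)) := by
    intro s d
    change s (M.face (dart (edge d))) + s (M.face (M.rev (dart (edge d)))) = _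
    rcases (hedge _ _).1 (hdart (edge d)) with h | h
    · rw [h]
    · rw [h, M.rev_rev, add_comm]
  have hβ : ∀ C d, β C (M.vtx d) = ∑ k ∈ Finset.range 5, C (edge ((M.next ^ k) d)) :=
    fun C d => sum_vtx_eq (fun d => C (edge d)) (hat (M.vtx d))
  -- the boundary of a set of faces is even
  have hle : LinearMap.range δ ≤ LinearMap.ker β := by
    rintro _ ⟨s, rfl⟩
    rw [LinearMap.mem_ker]
    ext x
    obtain ⟨d, rfl⟩ := hvtx x
    rw [hβ]
    simp only [hδ, ← M.face_next, Finset.sum_add_distrib]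
    have h := sum_next (M := M) (fun d => s (M.face d)) d
    have h' : ∀ k : ℕ, M.next ((M.next ^ k) d) = (M.next ^ k) (M.next d) := fun k => by
      rw [← Equiv.Perm.mul_apply, ← pow_succ', pow_succ, Equiv.Perm.mul_apply]
    simp only [h', h]
    exact CharTwo.add_self_eq_zero _
  -- a set of faces without boundary is a union of components
  have hker : Module.finrank (ZMod 2) (LinearMap.ker δ) ≤
      Fintype.card M.graph.ConnectedComponent := by
    let L : (M.Face → ZMod 2) →ₗ[ZMod 2] (M.graph.ConnectedComponent → ZMod 2) :=
      LinearMap.funLeft (ZMod 2) (ZMod 2) fun c => M.face (at' c.out)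
    have hinj : Function.Injective (L.domRestrict (LinearMap.ker δ)) := by
      rw [← LinearMap.ker_eq_bot, LinearMap.ker_eq_bot']
      rintro ⟨s, hs⟩ hL
      have hs' : ∀ d, s (M.face (M.rev d)) = s (M.face d) := by
        intro d
        have := congrFun (LinearMap.mem_ker.1 hs) (edge d)
        rw [hδ] at this
        exact (CharTwo.add_eq_zero.1 this).symm
      have hconst : ∀ d d', M.vtx d' = M.vtx d → s (M.face d') = s (M.face d) := by
        intro d d' h
        refine apply_of_step (M := M) (P := fun d' => s (M.face d') = s (M.face d)) ?_ rfl h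
        intro d'' h''
        rw [M.face_next, hs', h'']
      have hreach : ∀ x y, M.graph.Reachable x y →
          s (M.face (at' x)) = s (M.face (at' y)) := by
        intro x y h
        rw [SimpleGraph.reachable_iff_reflTransGen] at h
        induction h with
        | refl => rfl
        | tail _ hyz ih =>
          obtain ⟨-, d, rfl, rfl⟩ := hyz
          rw [ih, hconst d _ (hat _), hconst (M.rev d) _ (hat _), hs']
      apply Subtype.ext
      ext F
      induction F using Quotient.ind with
      | _ d =>
        have hc : M.graph.Reachable (M.vtx d) (M.graph.connectedComponentMk (M.vtx d)).out :=
          SimpleGraph.ConnectedComponent.exact (Quot.out_eq _).symm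
        have hz := congrFun hL (M.graph.connectedComponentMk (M.vtx d))
        have hz' : s (M.face (at' (M.graph.connectedComponentMk (M.vtx d)).out)) = 0 := hz
        rw [← hreach _ _ hc, hconst d _ (hat _)] at hz'
        exact hz'
    have := LinearMap.finrank_le_finrank_of_injective hinj
    rwa [Module.finrank_fintype_fun_eq_card] at this
  -- modulo boundaries of edge sets, the vertices of a component are equal
  have hquot : Module.finrank (ZMod 2) ((V → ZMod 2) ⧸ LinearMap.range β) ≤
      Fintype.card M.graph.ConnectedComponent := by
    let b : V → (V → ZMod 2) ⧸ LinearMap.range β :=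
      fun x => Submodule.Quotient.mk (Pi.single x 1)
    have hb : ∀ x y, M.graph.Reachable x y → b x = b y := by
      intro x y h
      rw [SimpleGraph.reachable_iff_reflTransGen] at h
      induction h with
      | refl => rfl
      | tail _ hyz ih =>
        obtain ⟨hne, d, rfl, rfl⟩ := hyz
        rw [ih, Submodule.Quotient.eq]
        refine ⟨Pi.single (edge d) 1, ?_⟩
        ext z
        obtain ⟨d', rfl⟩ := hvtx z
        rw [hβ]
        have h1 : ∀ d'', (Pi.single (edge d) 1 : E → ZMod 2) (edge d'') =
            (if d'' = d then 1 else 0) + (if d'' = M.rev d then 1 else 0) := by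
          intro d''
          have hr := M.rev_ne d
          rw [Pi.single_apply]
          by_cases h1 : d'' = d
          · subst h1
            simp [hr.symm]
          · by_cases h2 : d'' = M.rev d
            · simp [h2, hedge, hr]
            · simp [h1, h2, hedge]
        simp only [h1, Finset.sum_add_distrib, sum_indicator, Pi.sub_apply, Pi.single_apply,
          CharTwo.sub_eq_add]
    have hspan : Submodule.span (ZMod 2) (Set.range
        fun c : M.graph.ConnectedComponent => b c.out) = ⊤ := by
      rw [eq_top_iff]
      rintro y -
      obtain ⟨g, rfl⟩ := Submodule.Quotient.mk_surjective _ y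
      have hg : (Submodule.Quotient.mk g : (V → ZMod 2) ⧸ LinearMap.range β) =
          ∑ x, g x • b x := by
        have : g = ∑ x, g x • (Pi.single x 1 : V → ZMod 2) := by
          ext y
          simp [Finset.sum_apply, Pi.single_apply]
        conv_lhs => rw [this]
        change (LinearMap.range β).mkQ _ = _
        rw [map_sum]
        rfl
      rw [hg]
      refine Submodule.sum_mem _ fun x _ => Submodule.smul_mem _ _ (Submodule.subset_span ?_)
      exact ⟨M.graph.connectedComponentMk x,
        hb _ _ (SimpleGraph.ConnectedComponent.exact (Quot.out_eq _))⟩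
    rw [← finrank_top, ← hspan]
    exact finrank_range_le_card _
  have r1 := LinearMap.finrank_range_add_finrank_ker δ
  have r2 := LinearMap.finrank_range_add_finrank_ker β
  have r3 := Submodule.finrank_quotient_add_finrank (LinearMap.range β)
  rw [Module.finrank_fintype_fun_eq_card] at r1 r2 r3
  have heq : LinearMap.range δ = LinearMap.ker β :=
    Submodule.eq_of_le_of_finrank_le hle (by omega)
  intro C hrev hsum
  have hC : ∀ d, C (dart (edge d)) = C d := by
    intro d
    rcases (hedge _ _).1 (hdart (edge d)) with h | h
    · rw [h]
    · rw [h, hrev]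
  have hmem : (fun x => C (dart x)) ∈ LinearMap.ker β := by
    rw [LinearMap.mem_ker]
    ext x
    obtain ⟨d, rfl⟩ := hvtx x
    rw [hβ]
    simp only [hC, hsum]
    rfl
  rw [← heq] at hmem
  obtain ⟨s, hs⟩ := hmem
  refine ⟨fun d => s (M.face d), fun d => ⟨by beta_reduce; rw [M.face_next], ?_⟩⟩
  rw [← hC d, ← hδ, hs]

end FiveMap

/-! ### Multigraphs with a rotation system -/

namespace FiveMap

variable {D V : Type*} {M : FiveMap D V}

theorem ncard_vtx_mem [Finite D] [Finite V] (hvtx : Function.Surjective M.vtx) (X : Set V) :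
    {d | M.vtx d ∈ X}.ncard = 5 * X.ncard := by
  classical
  have := Fintype.ofFinite D
  have := Fintype.ofFinite V
  rw [Set.ncard_eq_toFinset_card', Set.ncard_eq_toFinset_card',
    Finset.card_eq_sum_card_fiberwise (f := M.vtx) (t := X.toFinset) (by intro d hd; simpa using hd),
    Finset.sum_const_nat (m := 5), mul_comm]
  intro x hx
  obtain ⟨d, rfl⟩ := hvtx x
  rw [← ncard_vtx_eq (M := M) d, Set.ncard_eq_toFinset_card']
  congr 1
  ext d'
  simp only [Finset.mem_filter, Set.mem_toFinset, Set.mem_ofPred_eq, and_iff_right_iff_imp]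
  intro h
  rw [h]
  simpa using hx

theorem odd_ncard_of_odd_cut [Finite D] [Finite V] (hvtx : Function.Surjective M.vtx) (X : Set V)
    (h : Odd (M.cut X).ncard) : Odd X.ncard := by
  have hu : {d | M.vtx d ∈ X} = {d | M.vtx d ∈ X ∧ M.vtx (M.rev d) ∈ X} ∪ M.cut X := by
    ext d
    simp only [cut, Set.mem_union, Set.mem_ofPred_eq]
    tauto
  have hd : Disjoint {d | M.vtx d ∈ X ∧ M.vtx (M.rev d) ∈ X} (M.cut X) := by
    rw [Set.disjoint_left]
    rintro d ⟨-, h1⟩ ⟨-, h2⟩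
    exact h2 h1
  have hL : Even {d | M.vtx d ∈ X ∧ M.vtx (M.rev d) ∈ X}.ncard :=
    Set.even_ncard_of_involution M.rev
      (fun a ha => ⟨ha.2, by rw [M.rev_rev]; exact ha.1⟩) M.rev_rev M.rev_ne
  have h5 := ncard_vtx_mem hvtx X
  rw [hu, Set.ncard_union_eq hd] at h5
  have : Odd (5 * X.ncard) := h5 ▸ hL.add_odd h
  exact (Nat.odd_mul.1 this).2

end FiveMap

theorem IsPattern.injective {q : ZMod 5 → ZMod 5} (h : IsPattern q) : Function.Injective q := by
  have hlin : ∀ s : ZMod 5, s = 1 ∨ s = -1 → ∀ i k l : ZMod 5, s * k + i = s * l + i → k = l := by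
    decide
  have hcube : ∀ a b : ZMod 5, 3 * a ^ 3 = 3 * b ^ 3 → a = b := by decide
  obtain ⟨s, i, hs, h | h⟩ := h
  · intro k l hkl
    rw [h, h] at hkl
    exact hlin s hs i k l hkl
  · intro k l hkl
    rw [h, h] at hkl
    exact hlin s hs i k l (hcube _ _ hkl)

/-- The colours `1` and `3` are never consecutive, nor are `2` and `4`. -/
theorem IsPattern.not_consecutive {q : ZMod 5 → ZMod 5} (h : IsPattern q) :
    ¬ (q 0 = 1 ∧ q 1 = 3) ∧ ¬ (q 0 = 3 ∧ q 1 = 1) ∧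
      ¬ (q 0 = 2 ∧ q 1 = 4) ∧ ¬ (q 0 = 4 ∧ q 1 = 2) := by
  obtain ⟨s, i, hs, h | h⟩ := h
  · rw [h 0, h 1]
    clear h
    revert s i
    decide
  · rw [h 0, h 1]
    clear h
    revert s i
    decide

namespace Graph

variable {α β : Type*} {G : Graph α β}

theorem Dart.isLink (d : G.Dart) : G.IsLink d.edge d.vertex d.rev.vertex := d.inc.isLink_other

theorem Dart.eq_or_eq_rev {d d' : G.Dart} (h : d.edge = d'.edge) : d = d' ∨ d = d'.rev := by
  have h1 := d.isLink.left_eq_or_eq (h ▸ d'.isLink)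
  exact h1.imp (fun h1 => Dart.ext h1 h) (fun h1 => Dart.ext h1 h)

theorem Dart.toEdge_eq_iff {d d' : G.Dart} : d.toEdge = d'.toEdge ↔ d = d' ∨ d = d'.rev := by
  constructor
  · exact fun h => Dart.eq_or_eq_rev (congrArg Subtype.val h)
  · rintro (rfl | rfl) <;> rfl

theorem Dart.toEdge_surjective : Function.Surjective (Dart.toEdge : G.Dart → E(G)) := by
  rintro ⟨e, he⟩
  obtain ⟨x, y, h⟩ := exists_isLink_of_mem_edgeSet he
  exact ⟨⟨x, e, h.inc_left⟩, rfl⟩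

theorem Dart.rev_ne [G.Loopless] (d : G.Dart) : d.rev ≠ d := by
  intro h
  have := d.isLink
  rw [h] at this
  exact G.not_isLoopAt _ _ this

theorem finite_dart (hV : V(G).Finite) (hE : E(G).Finite) : Finite G.Dart := by
  have := hV.to_subtype
  have := hE.to_subtype
  refine Finite.of_injective
    (fun d : G.Dart => ((⟨d.vertex, d.inc.vertex_mem⟩ : V(G)), d.toEdge)) fun d d' h => ?_
  simp only [Prod.mk.injEq, Subtype.mk.injEq] at h
  exact Dart.ext h.1 (congrArg Subtype.val h.2)

theorem ncard_dart_vertex_eq (v : α) :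
    {d : G.Dart | d.vertex = v}.ncard = (G.incidenceSet v).ncard := by
  have : G.incidenceSet v = Dart.edge '' {d : G.Dart | d.vertex = v} := by
    ext e
    constructor
    · exact fun he => ⟨⟨v, e, he⟩, rfl, rfl⟩
    · rintro ⟨d, rfl, rfl⟩
      exact d.inc
  rw [this, Set.InjOn.ncard_image]
  intro d hd d' hd' h
  exact Dart.ext (hd.trans hd'.symm) h

namespace RotationSystem

theorem isCycleOn (ρ : G.RotationSystem) (v : α) : ρ.next.IsCycleOn {d | d.vertex = v} := by
  refine ⟨⟨fun d hd => (ρ.vertex_next d).trans hd, ρ.next.injective.injOn, fun d hd => ?_⟩,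
    fun d hd d' hd' => ρ.sameCycle_next d d' (hd.trans hd'.symm)⟩
  refine ⟨ρ.next.symm d, ?_, Equiv.apply_symm_apply _ _⟩
  have := ρ.vertex_next (ρ.next.symm d)
  rw [Equiv.apply_symm_apply] at this
  exact this.symm.trans hd

theorem exists_isCycleOn_finset [Finite G.Dart] (ρ : G.RotationSystem) {n : ℕ}
    (hn : ∀ v ∈ V(G), (G.incidenceSet v).ncard = n) (d : G.Dart) :
    ∃ s : Finset G.Dart, s.card = n ∧ ρ.next.IsCycleOn s ∧ ∀ d', d' ∈ s ↔ d'.vertex = d.vertex := by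
  classical
  have := Fintype.ofFinite G.Dart
  refine ⟨{d' | d'.vertex = d.vertex}.toFinset, ?_, ?_, fun d' => by simp⟩
  · rw [← Set.ncard_eq_toFinset_card', ncard_dart_vertex_eq, hn _ d.inc.vertex_mem]
  · simpa using ρ.isCycleOn d.vertex

/-- The combinatorial map of a rotation system of a `5`-regular graph. -/
noncomputable def toFiveMap [G.Loopless] [Finite G.Dart] (ρ : G.RotationSystem)
    (h5 : ∀ v ∈ V(G), (G.incidenceSet v).ncard = 5) : FiveMap G.Dart V(G) where
  next := ρ.next
  rev := Dart.rev
  vtx d := ⟨d.vertex, d.inc.vertex_mem⟩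
  rev_rev := Dart.rev_involutive
  rev_ne := Dart.rev_ne
  vtx_next d := Subtype.ext (ρ.vertex_next d)
  next_ne d := by
    obtain ⟨s, hs, hc, hm⟩ := ρ.exists_isCycleOn_finset h5 d
    refine hc.apply_ne ?_ ((hm d).2 rfl)
    exact Finset.one_lt_card_iff_nontrivial.1 (by omega)
  next_pow := by
    ext1 d
    obtain ⟨s, hs, hc, hm⟩ := ρ.exists_isCycleOn_finset h5 d
    rw [← hs]
    exact hc.pow_card_apply ((hm d).2 rfl)
  exists_pow d d' h := by
    obtain ⟨s, hs, hc, hm⟩ := ρ.exists_isCycleOn_finset h5 d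
    rw [← hs]
    exact hc.exists_pow_eq ((hm d).2 rfl) ((hm d').2 (congrArg Subtype.val h).symm)

section

variable [G.Loopless] [Finite G.Dart] (ρ : G.RotationSystem)

theorem vtx_toFiveMap_surjective (h5 : ∀ v ∈ V(G), (G.incidenceSet v).ncard = 5) :
    Function.Surjective (ρ.toFiveMap h5).vtx := by
  rintro ⟨v, hv⟩
  have hne : (G.incidenceSet v).Nonempty := Set.nonempty_of_ncard_ne_zero (by rw [h5 v hv]; norm_num)
  obtain ⟨e, he⟩ := hne
  exact ⟨⟨v, e, he⟩, rfl⟩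

theorem graph_toFiveMap (h5 : ∀ v ∈ V(G), (G.incidenceSet v).ncard = 5) :
    (ρ.toFiveMap h5).graph = G.toSimpleGraph := by
  ext x y
  rw [toSimpleGraph_adj]
  refine and_congr_right fun _ => ?_
  constructor
  · rintro ⟨d, rfl, rfl⟩
    exact ⟨d.edge, d.isLink⟩
  · rintro ⟨e, he⟩
    refine ⟨⟨x, e, he.inc_left⟩, rfl, Subtype.ext ?_⟩
    exact (Dart.isLink (G := G) ⟨x, e, he.inc_left⟩).right_unique he

theorem oddCut_toFiveMap (hV : V(G).Finite) (hG : G.IsRGraph 5) :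
    (ρ.toFiveMap hG.1).OddCut := by
  have := hV.to_subtype
  intro X
  have hodd : Odd ((ρ.toFiveMap hG.1).cut X).ncard → 5 ≤ ((ρ.toFiveMap hG.1).cut X).ncard := by
    intro h
    have hX := FiveMap.odd_ncard_of_odd_cut (ρ.vtx_toFiveMap_surjective hG.1) X h
    rw [← Set.ncard_image_of_injective X Subtype.val_injective] at hX
    refine (hG.2 _ (by rintro _ ⟨x, -, rfl⟩; exact x.2) hX).trans ?_
    refine (Set.ncard_le_ncard ?_ (Set.toFinite _)).trans
      (Set.ncard_image_le (f := Dart.edge) (Set.toFinite _))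
    rintro e ⟨_, ⟨x, hx, rfl⟩, y, ⟨hy, hyX⟩, he⟩
    refine ⟨⟨x, e, he.inc_left⟩, ⟨hx, fun hc => hyX ?_⟩, rfl⟩
    refine ⟨_, hc, ?_⟩
    exact (Dart.isLink (G := G) ⟨x, e, he.inc_left⟩).right_unique he
  constructor
  · intro h
    have := hodd (by rw [h]; decide)
    omega
  · intro h
    have := hodd (by rw [h]; decide)
    omega

theorem jordan_toFiveMap (hV : V(G).Finite) (hE : E(G).Finite)
    (h5 : ∀ v ∈ V(G), (G.incidenceSet v).ncard = 5) (hplane : ρ.IsPlane) :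
    (ρ.toFiveMap h5).Jordan := by
  have := hV.to_subtype
  have := hE.to_subtype
  refine (ρ.toFiveMap h5).jordan_of_euler Dart.toEdge (fun _ _ => Dart.toEdge_eq_iff)
    Dart.toEdge_surjective (ρ.vtx_toFiveMap_surjective h5) ?_
  have hiso : {v | v ∈ V(G) ∧ G.incidenceSet v = ∅} = ∅ := by
    ext v
    simp only [Set.mem_ofPred_eq, Set.mem_empty_iff_false, iff_false, not_and]
    intro hv h0
    have := h5 v hv
    simp [h0] at this
  have hface : Nat.card (ρ.toFiveMap h5).Face = ρ.faceCount := by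
    rw [faceCount, hiso, Set.ncard_empty, add_zero]
    rfl
  rw [IsPlane, ← hface] at hplane
  rw [graph_toFiveMap, Nat.card_coe_set_eq, Nat.card_coe_set_eq]
  omega

end

/-- At every vertex, a pattern is one of the two cyclic orders of the theorem. -/
theorem hasCyclicOrder_of_pattern [G.Loopless] [Finite G.Dart] (ρ : G.RotationSystem)
    (h5 : ∀ v ∈ V(G), (G.incidenceSet v).ncard = 5) {f : G.Dart → ZMod 5}
    (hf : (ρ.toFiveMap h5).IsPatternColouring f) {C : Type*} (c : ZMod 5 → C) {g : E(G) → C}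
    (hg : ∀ d : G.Dart, g d.toEdge = c (f d)) {v : α} (hv : v ∈ V(G)) :
    ρ.HasCyclicOrder g v ![c 0, c 1, c 2, c 3, c 4] ∨
      ρ.HasCyclicOrder g v ![c 0, c 3, c 4, c 1, c 2] := by
  set M := ρ.toFiveMap h5 with hM
  obtain ⟨d, hd⟩ := ρ.vtx_toFiveMap_surjective h5 ⟨v, hv⟩
  have hread : ∀ (d : G.Dart) (a : Fin 5 → C), d.vertex = v →
      (∀ k : Fin 5, c (f ((M.next ^ ((k : ℕ) : ℤ)) d)) = a k) → ρ.ReadsClockwise g v a := by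
    intro d a hd ha
    have hvk : ∀ k : ℕ, ((M.next ^ k) d).vertex = v := fun k =>
      (congrArg Subtype.val (M.vtx_pow k d)).trans hd
    refine ⟨Equiv.ofBijective (fun k : Fin 5 => ⟨(M.next ^ (k : ℕ)) d, hvk k⟩) ⟨?_, ?_⟩, ?_⟩
    · intro k l hkl
      exact Fin.ext (M.pow_injOn d k.2 l.2 (congrArg Subtype.val hkl))
    · rintro ⟨d', hd'⟩
      obtain ⟨k, hk, rfl⟩ := M.exists_pow d d' (Subtype.ext (hd.trans hd'.symm))
      exact ⟨⟨k, hk⟩, rfl⟩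
    · intro k
      refine ⟨?_, ?_⟩
      · change M.next ((M.next ^ (k : ℕ)) d) = (M.next ^ ((k + 1 : Fin 5) : ℕ)) d
        rw [← Equiv.Perm.mul_apply, ← pow_succ', ← zpow_natCast, ← zpow_natCast,
          M.zpow_eq_zpow_iff]
        fin_cases k <;> rfl
      · rw [← ha k, ← hg, zpow_natCast]
        rfl
  obtain ⟨q, ⟨s, i, hs, hq⟩, hqf⟩ := hf.2 d
  have hstart : ∀ j k : ℤ, f ((M.next ^ k) ((M.next ^ j) d)) = q (k + j) := by
    intro j k
    rw [← Equiv.Perm.mul_apply, ← zpow_add, hqf]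
    push_cast
    rfl
  have hvj : ∀ j : ℤ, ((M.next ^ j) d).vertex = v := fun j =>
    (congrArg Subtype.val (M.vtx_zpow j d)).trans (congrArg Subtype.val hd)
  obtain ⟨j, rfl⟩ := ZMod.intCast_surjective i
  have hr : ∀ (r : ZMod 5 → ZMod 5) (a : Fin 5 → C), (∀ k : Fin 5, a k = c (r ((k : ℕ) : ZMod 5))) →
      (∀ k, q k = r (s * k + j)) → ρ.HasCyclicOrder g v a := by
    intro r a ha hqr
    -- a clockwise reading starts at the dart with colour `a 0`, and the clockwise reading of the
    -- reversed order at the dart with colour `a 4`, which follows the one with colour `a 0`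
    rcases hs with rfl | rfl
    · refine Or.inl (hread _ a (hvj (-j)) fun k => ?_)
      rw [hstart, hqr, ha]
      congr 2
      push_cast
      ring
    · refine Or.inr (hread _ _ (hvj (j + 1)) fun k => ?_)
      rw [hstart, hqr, ha]
      congr 2
      push_cast
      have h4 : ∀ k : Fin 5, ((k.rev : ℕ) : ZMod 5) = -1 - ((k : ℕ) : ZMod 5) := by decide
      rw [h4]
      ring
  rcases hq with hq | hq
  · refine Or.inl (hr (fun x => x) _ (fun k => ?_) hq)
    fin_cases k <;> rfl
  · refine Or.inr (hr (fun x => 3 * x ^ 3) _ (fun k => ?_) hq)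
    fin_cases k <;> exact congrArg c (by decide)

theorem isProper_of_pattern [G.Loopless] [Finite G.Dart] (ρ : G.RotationSystem)
    (h5 : ∀ v ∈ V(G), (G.incidenceSet v).ncard = 5) {f : G.Dart → ZMod 5}
    (hf : (ρ.toFiveMap h5).IsPatternColouring f) {C : Type*} {c : ZMod 5 → C}
    (hc : Function.Injective c) {g : E(G) → C} (hg : ∀ d : G.Dart, g d.toEdge = c (f d)) :
    G.IsProperEdgeColouring g := by
  rintro v ⟨e, he⟩ ⟨e', he'⟩ hi hi' hne heq
  have h1 := hg ⟨v, e, hi⟩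
  have h2 := hg ⟨v, e', hi'⟩
  have h3 : f ⟨v, e, hi⟩ = f ⟨v, e', hi'⟩ := hc (by rw [← h1, ← h2]; exact heq)
  obtain ⟨k, hk, hkd⟩ := (ρ.toFiveMap h5).exists_pow ⟨v, e, hi⟩ ⟨v, e', hi'⟩ rfl
  obtain ⟨q, hq, hqf⟩ := hf.2 ⟨v, e, hi⟩
  rw [← hkd, ← zpow_natCast, hqf] at h3
  have h0 := hqf 0
  rw [zpow_zero, Equiv.Perm.one_apply] at h0
  have h4 := hq.injective (h0.symm.trans h3)
  have hk0 : k = 0 := by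
    interval_cases k
    · rfl
    all_goals exact absurd h4 (by decide)
  subst hk0
  exact hne (Subtype.ext (congrArg Dart.edge hkd))

end RotationSystem

end Graph

theorem mainTheorem9 {α β : Type*} (G : Graph α β) [G.Loopless]
    (hV : V(G).Finite) (hE : E(G).Finite)
    (ρ : G.RotationSystem) (hplane : ρ.IsPlane)
    (hG : G.IsRGraph 5) (hK4 : G.IsK4MinorFree) :
    (∀ (C : Type*) (c : Fin 5 → C), Function.Injective c →
      ∃ f : E(G) → C, G.IsProperEdgeColouring f ∧
        ∀ v ∈ V(G), ρ.HasCyclicOrder f v ![c 0, c 1, c 2, c 3, c 4] ∨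
          ρ.HasCyclicOrder f v ![c 0, c 3, c 4, c 1, c 2]) ∧
    ∃ f : E(G) → Graph.ShadeColour, ρ.IsSuperProper f := by
  have := hV.to_subtype
  have := Graph.finite_dart hV hE
  obtain ⟨f, hf⟩ := (ρ.toFiveMap hG.1).exists_isPatternColouring (ρ.oddCut_toFiveMap hV hG)
    (ρ.jordan_toFiveMap hV hE hG.1 hplane) (by rw [ρ.graph_toFiveMap]; exact hK4)
  let dart : E(G) → G.Dart := Function.surjInv Graph.Dart.toEdge_surjective
  have hdart : ∀ d : G.Dart, f (dart d.toEdge) = f d := by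
    intro d
    rcases Graph.Dart.toEdge_eq_iff.1 (Function.surjInv_eq Graph.Dart.toEdge_surjective d.toEdge)
      with h | h
    · exact congrArg f h
    · exact (congrArg f h).trans (hf.1 d)
  refine ⟨fun C c hc => ⟨fun e => c (f (dart e)), ?_, fun v hv => ?_⟩, ?_⟩
  · exact ρ.isProper_of_pattern hG.1 hf (c := c) hc fun d => congrArg c (hdart d)
  · exact ρ.hasCyclicOrder_of_pattern hG.1 hf c (fun d => congrArg c (hdart d)) hv
  · let c : Fin 5 → Graph.ShadeColour := ![.green, .lightBlue, .lightRed, .darkBlue, .darkRed]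
    have hc : Function.Injective c := by
      intro a b h
      fin_cases a <;> fin_cases b <;> first | rfl | cases h
    have h1 : ∀ a, c a = .lightBlue → a = 1 := fun a h => hc (h.trans rfl)
    have h2 : ∀ a, c a = .lightRed → a = 2 := fun a h => hc (h.trans rfl)
    have h3 : ∀ a, c a = .darkBlue → a = 3 := fun a h => hc (h.trans rfl)
    have h4 : ∀ a, c a = .darkRed → a = 4 := fun a h => hc (h.trans rfl)
    refine ⟨fun e => c (f (dart e)), ρ.isProper_of_pattern hG.1 hf (c := c) hc
      fun d => congrArg c (hdart d), fun d => ?_⟩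
    obtain ⟨q, hq, hqf⟩ := hf.2 d
    have e0 : f (dart d.toEdge) = q 0 := (hdart d).trans (by simpa using hqf 0)
    have e1 : f (dart (ρ.next d).toEdge) = q 1 := (hdart _).trans ((hqf 1).trans (congrArg q Int.cast_one))
    obtain ⟨n1, n2, n3, n4⟩ := hq.not_consecutive
    beta_reduce
    rw [e0, e1]
    constructor
    · intro h
      rcases Sym2.eq_iff.1 h with ⟨a, b⟩ | ⟨a, b⟩
      · exact n1 ⟨h1 _ a, h3 _ b⟩
      · exact n2 ⟨h3 _ a, h1 _ b⟩
    · intro h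
      rcases Sym2.eq_iff.1 h with ⟨a, b⟩ | ⟨a, b⟩
      · exact n3 ⟨h2 _ a, h4 _ b⟩
      · exact n4 ⟨h4 _ a, h2 _ b⟩
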